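/- Let $N\ge 2$ be an integer and let $\mathcal B$ be an additive category. An $N$-complex $X$ in $\mathcal B$ is a diagram $\cdots\to X^i\xrightarrow{d_X^i}X^{i+1}\to\cdots$ $(i\in\mathbb Z)$ in $\mathcal B$ such that $d_X^{i+N-1}\cdots d_X^{i+1}d_X^{i}=0$ for all $i$; a morphism $f:X\to Y$ is a family $f^i:X^i\to Y^i$ commuting with the $d$'s. It is null-homotopic if there are morphisms $s^i:X^i\to Y^{i-N+1}$ with $$f^i=\sum_{j=1}^{N}d_Y^{i-1}\cdots d_Y^{i-N+j}\,s^{i+j-1}\,d_X^{i+j-2}\cdots d_X^{i}\qquad(i\in\mathbb Z),$$ where empty composites are identities. The homotopy category $\mathsf K_N(\mathcal B)$ has the $N$-complexes as objects and, as morphisms, the morphisms of $N$-complexes modulo null-homotopic ones. The mapping cone $C(f)$ of a morphism $f:X\to Y$ of $N$-complexes is given by $C(f)^m=Y^m\oplus\bigoplus_{i=m+1}^{m+N-1}X^i$ with differential $$d_{C(f)}^m(y;x_{m+1},\dots,x_{m+N-1})=\Big(d_Yy+f(x_{m+1});\ x_{m+2},\dots,x_{m+N-1},\ -\sum_{i=m+1}^{m+N-1}d_X^{\{m+N-i\}}x_i\Big),$$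 where $d^{\{k\}}$ denotes the composite of $k$ consecutive differentials. The suspension $\Sigma X$ is the quotient of $C(f)$ by $Y$, that is, $(\Sigma X)^m=\bigoplus_{i=m+1}^{m+N-1}X^i$ with the induced differential. The triangulated structure of $\mathsf K_N(\mathcal B)$ consists of the translation functor $\Sigma$ and of the distinguished triangles, which are the triangles isomorphic in $\mathsf K_N(\mathcal B)$ to some $X\xrightarrow{f}Y\to C(f)\to\Sigma X$, with the canonical inclusion and projection. All subcategories are full and closed under isomorphism. A pair $(\mathcal U,\mathcal V)$ of full subcategories of a triangulated category $\mathcal D$ is a stable t-structure if $\mathcal U=\Sigma\mathcal U$, $\mathcal V=\Sigma\mathcal V$, $\operatorname{Hom}_{\mathcal D}(\mathcal U,\mathcal V)=0$, and every $X\in\mathcal D$ lies in a distinguished triangle $U\to X\to V\to\Sigma U$ with $U\in\mathcal U$, $V\in\mathcal V$. An $n$-tuple $(\mathcal U_1,\dots,\mathcal U_n)$ of full triangulated subcategories of $\mathcal D$ is an $n$-gon of recollements in $\mathcal D$ if $(\mathcal U_i,\mathcal U_{i+1})$ is a stable t-structure in $\mathcal D$ for $1\le i\le n$, where $\mathcal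 U_{n+1}=\mathcal U_1$. For $s\in\mathbb Z$ and $0\le r<N$, let $\mathcal F_s^r$ be the full subcategory of $\mathsf K_N(\mathcal B)$ of the objects isomorphic in $\mathsf K_N(\mathcal B)$ to an $N$-complex $X$ such that $d_X^{i+k}$ is an identity morphism (in particular $X^{i+k}=X^{i+k+1}$) for all $i\equiv s \pmod N$ and all $0\le k<r$. Thus $\mathcal F_s^r$ depends only on $s$ modulo $N$, and $\mathcal F_s^0=\mathsf K_N(\mathcal B)$. **Corollary.** For any integer $s$, the $2N$-tuple $$(\mathcal F_{s+1}^{N-2},\ \mathcal F_{s}^{1},\ \mathcal F_{s+2}^{N-2},\ \mathcal F_{s+1}^{1},\ \dots,\ \mathcal F_{s+r+1}^{N-2},\ \mathcal F_{s+r}^{1},\ \dots,\ \mathcal F_{s+N-1}^{N-2},\ \mathcal F_{s+N-2}^{1},\ \mathcal F_{s}^{N-2},\ \mathcal F_{s+N-1}^{1})$$ of full triangulated subcategories is a $2N$-gon of recollements in $\mathsf K_N(\mathcal B)$. -/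

import Mathlib

open CategoryTheory CategoryTheory.Limits

universe v u

/-! ## Polygons of recollements

The notions below only involve the data of a triangulated structure: a category, its translation
functor and its class of distinguished triangles. -/

/-- A triangle `X ⟶ Y ⟶ Z ⟶ S X` in a category `C` with translation functor `S`. -/
structure TriangleOver {C : Type u} [Category.{v} C] (S : C ⥤ C) where
  {obj₁ obj₂ obj₃ : C}
  mor₁ : obj₁ ⟶ obj₂
  mor₂ : obj₂ ⟶ obj₃
  mor₃ : obj₃ ⟶ S.obj obj₁

/-- Two triangles are isomorphic if there are isomorphisms of the three objects which commute with
the three morphisms. -/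
def TriangleOver.Isomorphic {C : Type u} [Category.{v} C] {S : C ⥤ C}
    (T T' : TriangleOver S) : Prop :=
  ∃ (e₁ : T.obj₁ ≅ T'.obj₁) (e₂ : T.obj₂ ≅ T'.obj₂) (e₃ : T.obj₃ ≅ T'.obj₃),
    T.mor₁ ≫ e₂.hom = e₁.hom ≫ T'.mor₁ ∧
    T.mor₂ ≫ e₃.hom = e₂.hom ≫ T'.mor₂ ∧
    T.mor₃ ≫ S.map e₁.hom = e₃.hom ≫ T'.mor₃

section Polygon

variable {C : Type u} [Category.{v} C] [HasZeroMorphisms C] (S : C ⥤ C)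
  (dist : TriangleOver S → Prop)

/-- `U` is a full triangulated subcategory (closed under isomorphisms) of the category `C` with
translation functor `S` and distinguished triangles `dist`. The property `U.map S` is the
essential image of `U` under `S`. -/
structure IsFullTriangulatedSubcategory (U : ObjectProperty C) : Prop where
  of_iso : ∀ {X Y : C}, (X ≅ Y) → U X → U Y
  zero : ∃ X : C, IsZero X ∧ U X
  shift_eq : U.map S = U
  ext₁ : ∀ T : TriangleOver S, dist T → U T.obj₂ → U T.obj₃ → U T.obj₁
  ext₂ : ∀ T : TriangleOver S, dist T → U T.obj₁ → U T.obj₃ → U T.obj₂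
  ext₃ : ∀ T : TriangleOver S, dist T → U T.obj₁ → U T.obj₂ → U T.obj₃

/-- `(U, V)` is a stable t-structure: `U = S U`, `V = S V`, `Hom(U, V) = 0`, and every object `X`
lies in a distinguished triangle `A ⟶ X ⟶ B ⟶ S A` with `A` in `U` and `B` in `V`. -/
structure IsStableTStructure (U V : ObjectProperty C) : Prop where
  shift_left : U.map S = U
  shift_right : V.map S = V
  hom_eq_zero : ∀ {X Y : C}, U X → V Y → ∀ f : X ⟶ Y, f = 0
  exists_triangle : ∀ X : C, ∃ (A B : C) (a : A ⟶ X) (b : X ⟶ B) (c : B ⟶ S.obj A),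
    U A ∧ V B ∧ dist ⟨a, b, c⟩

/-- `(U 0, …, U (n - 1))` is an `n`-gon of recollements: the `U i` are full triangulated
subcategories, and `(U i, U (i + 1))` is a stable t-structure for all `i`, the indices being read
cyclically. -/
structure IsPolygonOfRecollements {n : ℕ} (U : Fin n → ObjectProperty C) : Prop where
  triangulated : ∀ i, IsFullTriangulatedSubcategory S dist (U i)
  stable : ∀ i, IsStableTStructure S dist (U i) (U (finRotate n i))

end Polygon

/-! ## N-complexes -/

section NComplexes

variable (B : Type u) [Category.{v} B] [Preadditive B]

/-- A diagram `⋯ ⟶ Xⁱ ⟶ Xⁱ⁺¹ ⟶ ⋯` in `B` is a functor from the ordered set `ℤ`, whose value at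
`i ≤ j` is the composite of the differentials from `Xⁱ` to `Xʲ`. It is an `N`-complex if any
composite of `N` consecutive differentials vanishes. -/
def isNComplex (N : ℕ) : ObjectProperty (ℤ ⥤ B) :=
  fun X => ∀ i : ℤ, X.map (homOfLE (show i ≤ i + N by omega)) = 0

/-- The category `C_N(B)` of `N`-complexes. -/
abbrev NComplex (N : ℕ) := (isNComplex B N).FullSubcategory

end NComplexes

namespace NComplex

section Basic

variable {B : Type u} [Category.{v} B] [Preadditive B]

/-- The composite of the differentials from `Xⁱ` to `Xʲ` if `i ≤ j`, and `0` otherwise. -/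
noncomputable def tr (X : ℤ ⥤ B) (i j : ℤ) : X.obj i ⟶ X.obj j :=
  if h : i ≤ j then X.map (homOfLE h) else 0

lemma tr_of_le (X : ℤ ⥤ B) {i j : ℤ} (h : i ≤ j) : tr X i j = X.map (homOfLE h) := dif_pos h

lemma tr_of_not_le (X : ℤ ⥤ B) {i j : ℤ} (h : ¬ i ≤ j) : tr X i j = 0 := dif_neg h

lemma map_eq_tr (X : ℤ ⥤ B) {i j : ℤ} (g : i ⟶ j) : X.map g = tr X i j := by
  rw [tr_of_le X (leOfHom g)]; rfl

@[simp] lemma tr_self (X : ℤ ⥤ B) (i : ℤ) : tr X i i = 𝟙 _ := by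
  rw [tr_of_le X le_rfl]; exact X.map_id i

lemma tr_comp (X : ℤ ⥤ B) {i j k : ℤ} (hij : i ≤ j) (hjk : j ≤ k) :
    tr X i j ≫ tr X j k = tr X i k := by
  rw [tr_of_le X hij, tr_of_le X hjk, tr_of_le X (hij.trans hjk), ← X.map_comp]; rfl

lemma tr_naturality {X Y : ℤ ⥤ B} (f : X ⟶ Y) (i j : ℤ) :
    tr X i j ≫ f.app j = f.app i ≫ tr Y i j := by
  by_cases h : i ≤ j
  · rw [tr_of_le X h, tr_of_le Y h, f.naturality]
  · rw [tr_of_not_le X h, tr_of_not_le Y h, zero_comp, comp_zero]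

lemma tr_eq_zero {N : ℕ} {X : ℤ ⥤ B} (hX : isNComplex B N X) {i j : ℤ} (h : i + N ≤ j) :
    tr X i j = 0 := by
  have h0 : tr X i (i + N) = 0 := by rw [tr_of_le X (by omega)]; exact hX i
  rw [← tr_comp X (show i ≤ i + N by omega) h, h0, zero_comp]

variable {N : ℕ}

/-- A morphism `f : X ⟶ Y` of `N`-complexes is null-homotopic if there are
`sⁱ : Xⁱ ⟶ Yⁱ⁻ᴺ⁺¹` such that `fⁱ` is the sum over `0 ≤ j < N` of the composites
`Xⁱ ⟶ Xⁱ⁺ʲ ⟶ Yⁱ⁺ʲ⁻ᴺ⁺¹ ⟶ Yⁱ`. -/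
def NullHomotopic {X Y : NComplex B N} (f : X ⟶ Y) : Prop :=
  ∃ s : ∀ i : ℤ, X.obj.obj i ⟶ Y.obj.obj (i - N + 1),
    ∀ i : ℤ, f.hom.app i = ∑ j : Fin N,
      X.obj.map (homOfLE (show i ≤ i + (j : ℕ) by omega)) ≫ s (i + (j : ℕ)) ≫
        Y.obj.map (homOfLE (show i + (j : ℕ) - N + 1 ≤ i by omega))

lemma NullHomotopic.zero {X Y : NComplex B N} : NullHomotopic (0 : X ⟶ Y) :=
  ⟨fun _ => 0, fun i => by simp⟩

lemma NullHomotopic.add {X Y : NComplex B N} {f g : X ⟶ Y} (hf : NullHomotopic f)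
    (hg : NullHomotopic g) : NullHomotopic (f + g) := by
  obtain ⟨s, hs⟩ := hf
  obtain ⟨t, ht⟩ := hg
  refine ⟨fun i => s i + t i, fun i => ?_⟩
  have : (f + g).hom.app i = f.hom.app i + g.hom.app i := rfl
  rw [this, hs, ht, ← Finset.sum_add_distrib]
  simp

lemma NullHomotopic.neg {X Y : NComplex B N} {f : X ⟶ Y} (hf : NullHomotopic f) :
    NullHomotopic (-f) := by
  obtain ⟨s, hs⟩ := hf
  refine ⟨fun i => - s i, fun i => ?_⟩
  have : (-f).hom.app i = - f.hom.app i := rfl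
  rw [this, hs, ← Finset.sum_neg_distrib]
  simp

lemma NullHomotopic.precomp {X Y Z : NComplex B N} (g : X ⟶ Y) {f : Y ⟶ Z}
    (hf : NullHomotopic f) : NullHomotopic (g ≫ f) := by
  obtain ⟨s, hs⟩ := hf
  refine ⟨fun i => g.hom.app i ≫ s i, fun i => ?_⟩
  have : (g ≫ f).hom.app i = g.hom.app i ≫ f.hom.app i := rfl
  rw [this, hs, Preadditive.comp_sum]
  simp

lemma NullHomotopic.postcomp {X Y Z : NComplex B N} {f : X ⟶ Y} (g : Y ⟶ Z)
    (hf : NullHomotopic f) : NullHomotopic (f ≫ g) := by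
  obtain ⟨s, hs⟩ := hf
  refine ⟨fun i => s i ≫ g.hom.app _, fun i => ?_⟩
  have : (f ≫ g).hom.app i = f.hom.app i ≫ g.hom.app i := rfl
  rw [this, hs, Preadditive.sum_comp]
  simp

variable (B N)

/-- Two morphisms of `N`-complexes are homotopic if their difference is null-homotopic. -/
def homotopic : HomRel (NComplex B N) := fun _ _ f g => NullHomotopic (f - g)

instance : Congruence (homotopic B N) where
  equivalence :=
    { refl := fun f => by
        change NullHomotopic (f - f)
        rw [sub_self]; exact .zero
      symm := fun {f g} h => by
        change NullHomotopic (g - f)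
        rw [← neg_sub]; exact NullHomotopic.neg h
      trans := fun {f g k} h h' => by
        change NullHomotopic (f - k)
        rw [← sub_add_sub_cancel f g k]; exact NullHomotopic.add h h' }
  comp_left := fun {_ _ _} f {g g'} h => by
    change NullHomotopic (f ≫ g - f ≫ g')
    rw [← Preadditive.comp_sub]; exact NullHomotopic.precomp f h
  comp_right := fun {_ _ _ f f'} g h => by
    change NullHomotopic (f ≫ g - f' ≫ g)
    rw [← Preadditive.sub_comp]; exact NullHomotopic.postcomp g h

end Basic

end NComplex

/-- The homotopy category `K_N(B)` of `N`-complexes. -/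
abbrev NHomotopyCategory (B : Type u) [Category.{v} B] [Preadditive B] (N : ℕ) :=
  Quotient (NComplex.homotopic B N)

namespace NHomotopyCategory

variable (B : Type u) [Category.{v} B] [Preadditive B] (N : ℕ)

noncomputable instance : Preadditive (NHomotopyCategory B N) :=
  Quotient.preadditive _ (fun _ _ f₁ f₂ g₁ g₂ hf hg => by
    change NComplex.NullHomotopic (f₁ + g₁ - (f₂ + g₂))
    rw [add_sub_add_comm]
    exact NComplex.NullHomotopic.add hf hg)

/-- The quotient functor `C_N(B) ⥤ K_N(B)`. -/
noncomputable abbrev quotient : NComplex B N ⥤ NHomotopyCategory B N := Quotient.functor _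

end NHomotopyCategory

/-! ## Suspension and mapping cone -/

namespace NComplex

section Cone

variable {B : Type u} [Category.{v} B] [Preadditive B] {N : ℕ}

/-- The entry `Xᵃ ⟶ Xᵇ` of the matrix of the composite of differentials `(ΣX)ᵐ ⟶ (ΣX)ⁿ`. -/
noncomputable def suspEntry (N : ℕ) (X : ℤ ⥤ B) (m a b : ℤ) : X.obj a ⟶ X.obj b :=
  (if a = b then tr X a b else 0) - (if b = m + N then tr X a b else 0)

lemma sum_suspEntry (X : ℤ ⥤ B) (m n a : ℤ) {Z : B} (h : ∀ b, X.obj b ⟶ Z) :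
    ∑ b : Finset.Ioo n (n + N), suspEntry N X m a b ≫ h b =
      (if a ∈ Finset.Ioo n (n + N) then h a else 0) -
        (if m + N ∈ Finset.Ioo n (n + N) then tr X a (m + N) ≫ h (m + N) else 0) := by
  rw [Finset.sum_coe_sort (Finset.Ioo n (n + (N : ℤ))) (fun b => suspEntry N X m a b ≫ h b)]
  simp only [suspEntry, Preadditive.sub_comp, ite_comp, zero_comp, Finset.sum_sub_distrib]
  rw [Finset.sum_ite_eq, Finset.sum_ite_eq', tr_self, Category.id_comp]

lemma suspEntry_comp {X : ℤ ⥤ B} (hX : isNComplex B N X) {m n p a c : ℤ} (hmn : m ≤ n)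
    (hnp : n ≤ p) (ha : a ∈ Finset.Ioo m (m + N)) (hc : c ∈ Finset.Ioo p (p + N)) :
    ∑ b : Finset.Ioo n (n + N), suspEntry N X m a b ≫ suspEntry N X n b c =
      suspEntry N X m a c := by
  rw [sum_suspEntry X m n a (fun b => suspEntry N X n b c)]
  rw [Finset.mem_Ioo] at ha hc
  simp only [Finset.mem_Ioo]
  by_cases hac : a = c
  · subst hac
    have h1 : n < a ∧ a < n + N := by omega
    have h2 : ¬ (a = n + (N : ℤ)) := by omega
    have h3 : ¬ (a = m + (N : ℤ)) := by omega
    have h4 : ¬ (m + (N : ℤ) = a) := by omega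
    simp [suspEntry, h1, h2, h3, h4]
  by_cases hcm : c = m + N
  · subst hcm
    by_cases hnm : m = n
    · subst hnm
      have h1 : m < a ∧ a < m + N := by omega
      simp [suspEntry, hac, h1]
    · have h1 : ¬ (m + (N : ℤ) = n + N) := by omega
      have h2 : n < m + (N : ℤ) ∧ m + (N : ℤ) < n + N := by omega
      have h3 : ¬ (m = n) := hnm
      simp [suspEntry, hac, h2, h3]
  by_cases hcn : c = n + N
  · subst hcn
    have h1 : ¬ (m + (N : ℤ) = n + N) := by omega
    have h1' : ¬ (n = m) := by omega
    have h1'' : ¬ (m = n) := by omega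
    by_cases hna : n < a
    · have h2 : n < m + (N : ℤ) ∧ m + (N : ℤ) < n + N := by omega
      have h3 : n < a ∧ a < n + N := by omega
      simp [suspEntry, hac, h2, h3, h1', h1'',
        tr_comp X (show a ≤ m + N by omega) (show m + (N : ℤ) ≤ n + N by omega)]
    · have h3 : tr X a (m + N) ≫ tr X (m + N) (n + N) = 0 := by
        rw [tr_comp X (show a ≤ m + N by omega) (show m + (N : ℤ) ≤ n + N by omega)]
        exact tr_eq_zero hX (by omega)
      simp [suspEntry, hac, hna, h1', h1'', h3]
  · have h1 : ¬ (m + (N : ℤ) = c) := fun h => hcm h.symm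
    simp [suspEntry, hac, hcm, hcn, h1]

lemma suspEntry_self (X : ℤ ⥤ B) {m a c : ℤ} (hc : c ∈ Finset.Ioo m (m + N)) :
    suspEntry N X m a c = if a = c then tr X a c else 0 := by
  rw [Finset.mem_Ioo] at hc
  rw [suspEntry, if_neg (show ¬ c = m + N by omega), sub_zero]

lemma suspEntry_eq_zero (X : ℤ ⥤ B) {m a c : ℤ} (ha : a < m + N) (hc : m + N < c) :
    suspEntry N X m a c = 0 := by
  rw [suspEntry, if_neg (by omega), if_neg (by omega), sub_zero]

lemma sum_fin_eq_sum_Ico {M : Type*} [AddCommMonoid M] (N : ℕ) (a : ℤ) (g : ℤ → M) :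
    ∑ j : Fin N, g (a + (j : ℕ)) = ∑ i ∈ Finset.Ico a (a + N), g i := by
  rw [Fin.sum_univ_eq_sum_range (fun j : ℕ => g (a + j)) N]
  refine Finset.sum_nbij' (fun j : ℕ => a + j) (fun i => (i - a).toNat) ?_ ?_ ?_ ?_ ?_
  · intro j hj
    simp only [Finset.mem_range, Finset.mem_Ico] at *
    omega
  · intro i hi
    simp only [Finset.mem_range, Finset.mem_Ico] at *
    omega
  · intro j hj
    simp
  · intro i hi
    simp only [Finset.mem_Ico] at *
    omega
  · intro j hj
    rfl

lemma sum_Ico_comp_tr {X Y : ℤ ⥤ B} (s : ∀ i, X.obj i ⟶ Y.obj (i - N + 1)) (a q c x y : ℤ)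
    (hc : q ≤ c) (hy : y ≤ q + N) :
    (∑ i ∈ Finset.Ico x y, tr X a i ≫ s i ≫ tr Y (i - N + 1) q) ≫ tr Y q c =
      ∑ i ∈ Finset.Ico x y, tr X a i ≫ s i ≫ tr Y (i - N + 1) c := by
  rw [Preadditive.sum_comp]
  refine Finset.sum_congr rfl fun i hi => ?_
  rw [Finset.mem_Ico] at hi
  rw [Category.assoc, Category.assoc, tr_comp Y (by omega) hc]

/-- The entry `Xᵃ ⟶ Yⁿ` of the matrix of the composite of differentials `C(f)ᵐ ⟶ C(f)ⁿ`. -/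
noncomputable def coneEntry (N : ℕ) {X Y : ℤ ⥤ B} (f : X ⟶ Y) (m n a : ℤ) : X.obj a ⟶ Y.obj n :=
  if n < m + N then tr X a n ≫ f.app n else 0

lemma coneEntry_comp {X Y : ℤ ⥤ B} (hX : isNComplex B N X) (f : X ⟶ Y) {m n p a : ℤ}
    (hmn : m ≤ n) (hnp : n ≤ p) (ha : a ∈ Finset.Ioo m (m + N)) :
    coneEntry N f m n a ≫ tr Y n p +
      ∑ b : Finset.Ioo n (n + N), suspEntry N X m a b ≫ coneEntry N f n p b =
      coneEntry N f m p a := by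
  rw [sum_suspEntry X m n a (fun b => coneEntry N f n p b)]
  rw [Finset.mem_Ioo] at ha
  simp only [Finset.mem_Ioo, coneEntry, ite_comp, zero_comp, comp_ite, comp_zero, Category.assoc]
  rw [← tr_naturality]
  have hcomp : ∀ b, b ≤ p → a ≤ b → tr X a b ≫ tr X b p ≫ f.app p = tr X a p ≫ f.app p :=
    fun b hb hab => by rw [← Category.assoc, tr_comp X hab hb]
  by_cases han : a ≤ n
  · rw [hcomp n hnp han, if_neg (show ¬ (n < a ∧ a < n + N) by omega), zero_sub]
    by_cases hnm : n < m + N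
    · rw [if_pos hnm, if_pos (show n < m + (N : ℤ) ∧ m + (N : ℤ) < n + N by omega)]
      by_cases hpm : p < m + N
      · rw [if_pos hpm, if_pos (show p < n + (N : ℤ) by omega), tr_of_not_le X
          (show ¬ m + (N : ℤ) ≤ p by omega)]
        simp
      · rw [if_neg hpm, hcomp _ (by omega) (by omega)]
        by_cases hpn : p < n + N
        · rw [if_pos hpn, add_neg_cancel]
        · rw [if_neg hpn, tr_eq_zero hX (show a + (N : ℤ) ≤ p by omega)]
          simp
    · rw [if_neg hnm, if_neg (show ¬ (n < m + (N : ℤ) ∧ m + (N : ℤ) < n + N) by omega),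
        if_neg (show ¬ p < m + (N : ℤ) by omega)]
      simp
  · rw [tr_of_not_le X han, if_pos (show n < a ∧ a < n + (N : ℤ) by omega)]
    simp only [zero_comp, ite_self, zero_add]
    by_cases hpm : p < m + N
    · rw [if_pos hpm, if_pos (show p < n + (N : ℤ) by omega), tr_of_not_le X
          (show ¬ m + (N : ℤ) ≤ p by omega)]
      simp
    · rw [if_neg hpm, hcomp _ (by omega) (by omega)]
      by_cases hpn : p < n + N
      · rw [if_pos hpn, if_pos (show n < m + (N : ℤ) ∧ m + (N : ℤ) < n + N by omega), sub_self]
      · rw [if_neg hpn]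
        simp

variable [HasFiniteBiproducts B]

attribute [local instance] hasBinaryBiproducts_of_finite_biproducts

lemma matrix_comp_matrix {J K L : Type} [Finite J] [Fintype K] [Finite L] {F : J → B} {G : K → B}
    {H : L → B} (M : ∀ j k, F j ⟶ G k) (M' : ∀ k l, G k ⟶ H l) :
    biproduct.matrix M ≫ biproduct.matrix M' =
      biproduct.matrix (fun j l => ∑ k, M j k ≫ M' k l) := by
  ext j l
  simp [biproduct.matrix_π, biproduct.lift_desc]

/-- The diagram underlying the suspension `ΣX`: one has `(ΣX)ᵐ = ⨁_{m < i < m + N} Xⁱ`, and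
the differential `(ΣX)ᵐ ⟶ (ΣX)ᵐ⁺¹` is the identity from the summand `Xⁱ` to the summand `Xⁱ` for
`m + 1 < i < m + N`, it is `-dᵐ⁺ᴺ⁻ⁱ` from the summand `Xⁱ` to the summand `Xᵐ⁺ᴺ` for all `i`,
and its other entries vanish. -/
noncomputable def suspDiagram {X : ℤ ⥤ B} (hX : isNComplex B N X) : ℤ ⥤ B where
  obj m := ⨁ fun i : Finset.Ioo m (m + N) => X.obj i
  map {m _} _ := biproduct.matrix fun a b => suspEntry N X m a b
  map_id m := by
    apply biproduct.hom_ext'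
    intro a
    apply biproduct.hom_ext
    intro b
    rw [Category.assoc, biproduct.matrix_π, biproduct.ι_desc, Category.comp_id,
      suspEntry_self X b.2]
    by_cases h : a = b
    · subst h
      simp
    · rw [if_neg (fun h' => h (Subtype.ext h')), biproduct.ι_π_ne _ h]
  map_comp {m n p} f g := by
    rw [matrix_comp_matrix]
    congr 1
    funext a c
    exact (suspEntry_comp hX (leOfHom f) (leOfHom g) a.2 c.2).symm

lemma suspDiagram_isNComplex {X : ℤ ⥤ B} (hX : isNComplex B N X) :
    isNComplex B N (suspDiagram hX) := fun m => by
  change biproduct.matrix (fun (a : Finset.Ioo m (m + N))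
    (b : Finset.Ioo (m + (N : ℤ)) (m + N + N)) => suspEntry N X m a b) = 0
  ext a b
  have ha := Finset.mem_Ioo.1 a.2
  have hb := Finset.mem_Ioo.1 b.2
  simp only [biproduct.matrix_π, biproduct.ι_desc, comp_zero, zero_comp]
  exact suspEntry_eq_zero X hb.2 ha.1

variable (B N) in
/-- The suspension functor on `C_N(B)`, which acts diagonally on morphisms. -/
noncomputable def suspension : NComplex B N ⥤ NComplex B N where
  obj X := ⟨suspDiagram X.property, suspDiagram_isNComplex X.property⟩
  map {X Y} f := ObjectProperty.homMk
    { app := fun m => biproduct.map fun i : Finset.Ioo m (m + (N : ℤ)) => f.hom.app i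
      naturality := fun m n g => by
        apply biproduct.hom_ext'
        intro a
        apply biproduct.hom_ext
        intro b
        simp [suspDiagram, suspEntry, ite_comp, comp_ite, tr_naturality] }
  map_id X := by
    ext m
    have h : biproduct.map (fun i : Finset.Ioo m (m + (N : ℤ)) => 𝟙 (X.obj.obj i)) = 𝟙 _ := by
      apply biproduct.hom_ext
      intro a
      rw [biproduct.map_π, Category.comp_id, Category.id_comp]
    exact h
  map_comp {X Y Z} f g := by
    ext m
    have h : biproduct.map (fun i : Finset.Ioo m (m + (N : ℤ)) => f.hom.app i ≫ g.hom.app i) =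
        biproduct.map (fun i : Finset.Ioo m (m + (N : ℤ)) => f.hom.app i) ≫
          biproduct.map (fun i : Finset.Ioo m (m + (N : ℤ)) => g.hom.app i) := by
      apply biproduct.hom_ext
      intro a
      simp only [biproduct.map_π, Category.assoc, biproduct.map_π_assoc]
    exact h

/-- The suspension functor preserves null-homotopic morphisms. -/
lemma NullHomotopic.suspension {X Y : NComplex B N} {f : X ⟶ Y} (hf : NullHomotopic f) :
    NullHomotopic ((suspension B N).map f) := by
  obtain ⟨s, hs⟩ := hf
  have hs' : ∀ a, f.hom.app a = ∑ i ∈ Finset.Ico a (a + (N : ℤ)),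
      tr X.obj a i ≫ s i ≫ tr Y.obj (i - N + 1) a := fun a => by
    rw [hs, ← sum_fin_eq_sum_Ico]
    exact Finset.sum_congr rfl fun j _ => by rw [map_eq_tr, map_eq_tr]
  let G : ∀ q c b : ℤ, X.obj.obj b ⟶ Y.obj.obj c := fun q c b =>
    ∑ i ∈ Finset.Ico b (q + (N : ℤ)), tr X.obj b i ≫ s i ≫ tr Y.obj (i - N + 1) c
  let T : ∀ q c b : ℤ, X.obj.obj b ⟶ Y.obj.obj c := fun q c b => if c = q then - G q c b else 0
  refine ⟨fun q => biproduct.matrix (fun (b : Finset.Ioo q (q + (N : ℤ)))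
    (c : Finset.Ioo (q - (N : ℤ) + 1) (q - N + 1 + N)) => T q c b), fun m => ?_⟩
  change biproduct.map (fun i : Finset.Ioo m (m + (N : ℤ)) => f.hom.app i) =
    ∑ j : Fin N, biproduct.matrix (fun (a : Finset.Ioo m (m + (N : ℤ)))
        (b : Finset.Ioo (m + (j : ℕ)) (m + (j : ℕ) + (N : ℤ))) => suspEntry N X.obj m a b) ≫
      biproduct.matrix (fun (b : Finset.Ioo (m + (j : ℕ)) (m + (j : ℕ) + (N : ℤ)))
        (c : Finset.Ioo (m + (j : ℕ) - (N : ℤ) + 1) (m + (j : ℕ) - N + 1 + N)) =>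
          T (m + (j : ℕ)) c b) ≫
      biproduct.matrix (fun (c : Finset.Ioo (m + (j : ℕ) - (N : ℤ) + 1) (m + (j : ℕ) - N + 1 + N))
        (l : Finset.Ioo m (m + (N : ℤ))) => suspEntry N Y.obj (m + (j : ℕ) - N + 1) c l)
  simp only [← Category.assoc]
  simp only [matrix_comp_matrix]
  apply biproduct.hom_ext'
  intro a
  apply biproduct.hom_ext
  intro l
  obtain ⟨a, ha⟩ := a
  obtain ⟨l, hl⟩ := l
  rw [Preadditive.comp_sum, Preadditive.sum_comp]
  simp only [Category.assoc]
  simp only [biproduct.matrix_π, biproduct.ι_desc]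
  let V : ∀ q : ℤ, X.obj.obj a ⟶ Y.obj.obj q := fun q =>
    (if q < a then - G q q a else 0) +
      (if m < q then tr X.obj a (m + N) ≫ G q q (m + N) else 0)
  rw [Finset.mem_Ioo] at ha hl
  have hent : ∀ q : ℤ, m ≤ q → q < m + N →
      ∑ c : Finset.Ioo (q - (N : ℤ) + 1) (q - N + 1 + N),
        (∑ b : Finset.Ioo q (q + (N : ℤ)), suspEntry N X.obj m a b ≫ T q c b) ≫
          suspEntry N Y.obj (q - N + 1) c l = V q ≫ suspEntry N Y.obj (q - N + 1) q l := by
    intro q h1 h2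
    have h3 : ∀ c : ℤ, ∑ b : Finset.Ioo q (q + (N : ℤ)), suspEntry N X.obj m a b ≫ T q c b =
        if c = q then (if q < a then - G q c a else 0) +
          (if m < q then tr X.obj a (m + N) ≫ G q c (m + N) else 0) else 0 := by
      intro c
      rw [sum_suspEntry X.obj m q a (fun b => T q c b)]
      have e1 : (a ∈ Finset.Ioo q (q + (N : ℤ))) = (q < a) := by
        rw [Finset.mem_Ioo, eq_iff_iff]; omega
      have e2 : (m + (N : ℤ) ∈ Finset.Ioo q (q + (N : ℤ))) = (m < q) := by
        rw [Finset.mem_Ioo, eq_iff_iff]; omega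
      simp only [e1, e2, T]
      by_cases hc : c = q
      · simp only [if_pos hc]
        by_cases hq : m < q
        · simp only [if_pos hq, Preadditive.comp_neg, sub_neg_eq_add]
        · simp only [if_neg hq, sub_zero, add_zero]
      · simp only [if_neg hc, comp_zero, ite_self, sub_zero]
    simp only [h3]
    rw [Finset.sum_coe_sort (Finset.Ioo (q - (N : ℤ) + 1) (q - N + 1 + N)) (fun c =>
      (if c = q then (if q < a then - G q c a else 0) +
          (if m < q then tr X.obj a (m + N) ≫ G q c (m + N) else 0) else 0) ≫
            suspEntry N Y.obj (q - N + 1) c l)]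
    simp only [ite_comp, zero_comp]
    rw [Finset.sum_ite_eq', if_pos (Finset.mem_Ioo.2 (by omega))]
  have hlhs : biproduct.ι (fun i : Finset.Ioo m (m + (N : ℤ)) => X.obj.obj i)
        ⟨a, Finset.mem_Ioo.2 ha⟩ ≫
      biproduct.map (fun i : Finset.Ioo m (m + (N : ℤ)) => f.hom.app i) ≫
      biproduct.π (fun i : Finset.Ioo m (m + (N : ℤ)) => Y.obj.obj i)
        ⟨l, Finset.mem_Ioo.2 hl⟩ = if a = l then f.hom.app a ≫ tr Y.obj a l else 0 := by
    rw [biproduct.map_π]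
    by_cases hal : a = l
    · subst hal
      simp
    · rw [if_neg hal, ← Category.assoc, biproduct.ι_π_ne _ (by simpa using hal), zero_comp]
  rw [hlhs, Finset.sum_congr rfl (fun (j : Fin N) _ =>
    hent (m + (j : ℕ)) (by omega) (by have := j.2; omega)),
    sum_fin_eq_sum_Ico N m (fun q => V q ≫ suspEntry N Y.obj (q - N + 1) q l)]
  have hsum : ∑ q ∈ Finset.Ico m (m + (N : ℤ)), V q ≫ suspEntry N Y.obj (q - N + 1) q l =
      V l - V (l - 1) ≫ tr Y.obj (l - 1) l := by
    have e : ∀ q : ℤ, (l = q - (N : ℤ) + 1 + N) = (q = l - 1) := fun q => by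
      rw [eq_iff_iff]; omega
    simp only [suspEntry, e, Preadditive.comp_sub, comp_ite, comp_zero, Finset.sum_sub_distrib]
    rw [Finset.sum_ite_eq', Finset.sum_ite_eq', if_pos (Finset.mem_Ico.2 (by omega)),
      if_pos (Finset.mem_Ico.2 (by omega)), tr_self, Category.comp_id]
  rw [hsum]
  let H : ℤ → (X.obj.obj a ⟶ Y.obj.obj l) := fun i =>
    tr X.obj a i ≫ s i ≫ tr Y.obj (i - N + 1) l
  have hG : ∀ q, tr X.obj a (m + N) ≫ G q l (m + N) =
      ∑ i ∈ Finset.Ico (m + (N : ℤ)) (q + N), H i := by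
    intro q
    simp only [G, H, Preadditive.comp_sum]
    refine Finset.sum_congr rfl fun i hi => ?_
    rw [Finset.mem_Ico] at hi
    rw [← Category.assoc, tr_comp X.obj (by omega) hi.1]
  have hGt : ∀ b, G (l - 1) (l - 1) b ≫ tr Y.obj (l - 1) l = G (l - 1) l b := fun b => by
    simp only [G]
    exact sum_Ico_comp_tr s b (l - 1) l b _ (by omega) le_rfl
  have hVl : V l = (if l < a then - G l l a else 0) +
      ∑ i ∈ Finset.Ico (m + (N : ℤ)) (l + N), H i := by
    simp only [V]
    rw [if_pos hl.1, hG]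
  have hVl' : V (l - 1) ≫ tr Y.obj (l - 1) l = (if l - 1 < a then - G (l - 1) l a else 0) +
      ∑ i ∈ Finset.Ico (m + (N : ℤ)) (l - 1 + N), H i := by
    simp only [V, Preadditive.add_comp, ite_comp, zero_comp, Preadditive.neg_comp, hGt,
      Category.assoc, hG]
    congr 1
    by_cases hm : m < l - 1
    · rw [if_pos hm]
    · rw [if_neg hm, Finset.Ico_eq_empty (by omega), Finset.sum_empty]
  have hsucc : ∀ x : ℤ, x ≤ l - 1 + N → ∑ i ∈ Finset.Ico x (l + N), H i =
      ∑ i ∈ Finset.Ico x (l - 1 + N), H i + H (l - 1 + N) := by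
    intro x hx
    have : Finset.Ico x (l + (N : ℤ)) = insert (l - 1 + (N : ℤ)) (Finset.Ico x (l - 1 + N)) := by
      ext y
      simp only [Finset.mem_Ico, Finset.mem_insert]
      omega
    rw [this, Finset.sum_insert (by simp), add_comm]
  have hGH : ∀ q, G q l a = ∑ i ∈ Finset.Ico a (q + (N : ℤ)), H i := fun q => rfl
  rw [hVl, hVl', hGH, hGH, hsucc _ (by omega), hsucc _ (by omega)]
  rcases lt_trichotomy l a with h | h | h
  · rw [if_neg (by omega), if_pos h, if_pos (by omega)]
    abel
  · subst h
    have hf : f.hom.app l = ∑ i ∈ Finset.Ico l (l + (N : ℤ)), H i := hs' l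
    rw [if_pos rfl, if_neg (by omega), if_pos (by omega), tr_self, Category.comp_id, hf,
      hsucc _ (by omega)]
    abel
  · have h0 : H (l - 1 + N) = 0 := by
      simp only [H]
      rw [tr_eq_zero X.property (by omega), zero_comp]
    rw [if_neg (by omega), if_neg (by omega), if_neg (by omega), h0]
    abel

/-- The component `(ΣX)ᵐ ⟶ Yⁿ` of the composite of differentials `C(f)ᵐ ⟶ C(f)ⁿ`. -/
noncomputable def coneComponent {X Y : NComplex B N} (f : X ⟶ Y) (m n : ℤ) :
    (suspDiagram X.property).obj m ⟶ Y.obj.obj n :=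
  biproduct.desc fun a : Finset.Ioo m (m + (N : ℤ)) => coneEntry N f.hom m n a

lemma coneComponent_self {X Y : NComplex B N} (f : X ⟶ Y) (m : ℤ) :
    coneComponent f m m = 0 := by
  have h : biproduct.desc (fun a : Finset.Ioo m (m + (N : ℤ)) => coneEntry N f.hom m m a) =
      0 := by
    apply biproduct.hom_ext'
    intro a
    have ha := Finset.mem_Ioo.1 a.2
    rw [biproduct.ι_desc, comp_zero, coneEntry, tr_of_not_le _ (by omega), zero_comp, ite_self]
  exact h

lemma coneComponent_add {X Y : NComplex B N} (f : X ⟶ Y) (m : ℤ) :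
    coneComponent f m (m + N) = 0 := by
  have h : biproduct.desc (fun a : Finset.Ioo m (m + (N : ℤ)) =>
      coneEntry N f.hom m (m + N) a) = 0 := by
    apply biproduct.hom_ext'
    intro a
    rw [biproduct.ι_desc, comp_zero, coneEntry, if_neg (by omega)]
  exact h

lemma coneComponent_comp {X Y : NComplex B N} (f : X ⟶ Y) {m n p : ℤ} (g : m ⟶ n) (g' : n ⟶ p) :
    coneComponent f m p = coneComponent f m n ≫ Y.obj.map g' +
      (suspDiagram X.property).map g ≫ coneComponent f n p := by
  have h : biproduct.desc (fun a : Finset.Ioo m (m + (N : ℤ)) => coneEntry N f.hom m p a) =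
      biproduct.desc (fun a : Finset.Ioo m (m + (N : ℤ)) => coneEntry N f.hom m n a) ≫
        Y.obj.map g' +
      biproduct.matrix (fun (a : Finset.Ioo m (m + (N : ℤ))) (b : Finset.Ioo n (n + (N : ℤ))) =>
        suspEntry N X.obj m a b) ≫
        biproduct.desc (fun a : Finset.Ioo n (n + (N : ℤ)) => coneEntry N f.hom n p a) := by
    apply biproduct.hom_ext'
    intro a
    have h' := coneEntry_comp X.property f.hom (leOfHom g) (leOfHom g') a.2
    rw [← map_eq_tr Y.obj g'] at h'
    rw [Preadditive.comp_add, biproduct.ι_desc, biproduct.ι_desc_assoc, biproduct.ι_matrix_assoc,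
      biproduct.lift_desc]
    exact h'.symm
  exact h

/-- The diagram underlying the mapping cone `C(f)` of a morphism `f : X ⟶ Y`: one has
`C(f)ᵐ = Yᵐ ⊞ (ΣX)ᵐ = Yᵐ ⊞ ⨁_{m < i < m + N} Xⁱ`, and the differential `C(f)ᵐ ⟶ C(f)ᵐ⁺¹` is given
by the differentials of `Y` and of `ΣX` and by `fᵐ⁺¹` from the summand `Xᵐ⁺¹` to `Yᵐ⁺¹`. -/
noncomputable def coneDiagram {X Y : NComplex B N} (f : X ⟶ Y) : ℤ ⥤ B where
  obj m := Y.obj.obj m ⊞ (suspDiagram X.property).obj m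
  map {m n} g := biprod.desc (Y.obj.map g ≫ biprod.inl)
    (biprod.lift (coneComponent f m n) ((suspDiagram X.property).map g))
  map_id m := by
    rw [coneComponent_self]
    ext <;> simp
  map_comp {m n p} g g' := by
    rw [coneComponent_comp f g g']
    ext <;> simp [biprod.lift_desc]

lemma coneDiagram_isNComplex {X Y : NComplex B N} (f : X ⟶ Y) :
    isNComplex B N (coneDiagram f) := fun m => by
  have h : biprod.desc (Y.obj.map (homOfLE (show m ≤ m + N by omega)) ≫
      (biprod.inl : _ ⟶ _ ⊞ (suspDiagram X.property).obj (m + N)))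
      (biprod.lift (coneComponent f m (m + N))
        ((suspDiagram X.property).map (homOfLE (show m ≤ m + N by omega)))) = 0 := by
    rw [coneComponent_add, Y.property m, suspDiagram_isNComplex X.property m]
    ext <;> simp
  exact h

/-- The mapping cone `C(f)`. -/
noncomputable def cone {X Y : NComplex B N} (f : X ⟶ Y) : NComplex B N :=
  ⟨coneDiagram f, coneDiagram_isNComplex f⟩

/-- The inclusion `Y ⟶ C(f)`. -/
noncomputable def coneInl {X Y : NComplex B N} (f : X ⟶ Y) : Y ⟶ cone f :=
  ObjectProperty.homMk
    { app := fun m => (biprod.inl : Y.obj.obj m ⟶ Y.obj.obj m ⊞ (suspDiagram X.property).obj m)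
      naturality := fun m n g => by
        exact (biprod.inl_desc _ _).symm }

/-- The projection `C(f) ⟶ ΣX`. -/
noncomputable def coneSnd {X Y : NComplex B N} (f : X ⟶ Y) : cone f ⟶ (suspension B N).obj X :=
  ObjectProperty.homMk
    { app := fun m => (biprod.snd : Y.obj.obj m ⊞ (suspDiagram X.property).obj m ⟶ _)
      naturality := fun m n g => by
        have h : biprod.desc (Y.obj.map g ≫ biprod.inl)
            (biprod.lift (coneComponent f m n) ((suspDiagram X.property).map g)) ≫ biprod.snd =
            biprod.snd ≫ (suspDiagram X.property).map g := by
          ext <;> simp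
        exact h }

end Cone

section Subcategory

variable (B : Type u) [Category.{v} B] [Preadditive B] (N : ℕ)

/-- The `N`-complexes `X` such that `dⁱ⁺ᵏ : Xⁱ⁺ᵏ ⟶ Xⁱ⁺ᵏ⁺¹` is an identity morphism for all
`i ≡ s mod N` and `0 ≤ k < r`. -/
def hasIdentities (s : ℤ) (r : ℕ) : ObjectProperty (NComplex B N) :=
  fun X => ∀ (i : ℤ) (k : ℕ), i ≡ s [ZMOD N] → k < r →
    ∃ h : X.obj.obj (i + k) = X.obj.obj (i + k + 1),
      X.obj.map (homOfLE (show i + k ≤ i + k + 1 by omega)) = eqToHom h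

end Subcategory

end NComplex

namespace NHomotopyCategory

variable (B : Type u) [Category.{v} B] [Preadditive B] (N : ℕ)

/-- The full subcategory `F_s^r` of `K_N(B)`: the objects which are isomorphic in `K_N(B)` to an
`N`-complex such that `dⁱ⁺ᵏ` is an identity morphism for all `i ≡ s mod N` and `0 ≤ k < r`. -/
def F (s : ℤ) (r : ℕ) : ObjectProperty (NHomotopyCategory B N) :=
  (NComplex.hasIdentities B N s r).map (quotient B N)

variable [HasFiniteBiproducts B]

/-- The translation functor `Σ` of `K_N(B)`. -/
noncomputable def translation : NHomotopyCategory B N ⥤ NHomotopyCategory B N :=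
  CategoryTheory.Quotient.lift _ (NComplex.suspension B N ⋙ quotient B N) (fun _ _ f g h => by
    have h' := NComplex.NullHomotopic.suspension (f := f - g) h
    refine CategoryTheory.Quotient.sound _ ?_
    have e : (NComplex.suspension B N).map f - (NComplex.suspension B N).map g =
        (NComplex.suspension B N).map (f - g) := by
      ext m
      have e : biproduct.map (fun i : Finset.Ioo m (m + (N : ℤ)) => f.hom.app i) -
          biproduct.map (fun i : Finset.Ioo m (m + (N : ℤ)) => g.hom.app i) =
          biproduct.map (fun i : Finset.Ioo m (m + (N : ℤ)) => f.hom.app i - g.hom.app i) := by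
        apply biproduct.hom_ext
        intro a
        simp only [Preadditive.sub_comp, biproduct.map_π, Preadditive.comp_sub]
      exact e
    change NComplex.NullHomotopic _
    rw [e]
    exact h')

variable {B N}

/-- The triangle `X ⟶ Y ⟶ C(f) ⟶ ΣX` of `K_N(B)` attached to a morphism `f : X ⟶ Y` of
`N`-complexes. -/
noncomputable def coneTriangle {X Y : NComplex B N} (f : X ⟶ Y) : TriangleOver (translation B N) :=
  TriangleOver.mk (obj₁ := (quotient B N).obj X) (obj₂ := (quotient B N).obj Y)
    (obj₃ := (quotient B N).obj (NComplex.cone f))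
    ((quotient B N).map f) ((quotient B N).map (NComplex.coneInl f))
    ((quotient B N).map (NComplex.coneSnd f))

variable (B N)

/-- The distinguished triangles of `K_N(B)` are the triangles which are isomorphic to the triangle
of a mapping cone. -/
def distinguished (T : TriangleOver (translation B N)) : Prop :=
  ∃ (X Y : NComplex B N) (f : X ⟶ Y), T.Isomorphic (coneTriangle f)

/-- The `2N`-tuple
`(F_{s+1}^{N-2}, F_s^1, F_{s+2}^{N-2}, F_{s+1}^1, …, F_{s+N}^{N-2}, F_{s+N-1}^1)` of subcategories
of `K_N(B)`, where `F_{s+N}^{N-2} = F_s^{N-2}`. -/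
def polygon (s : ℤ) (i : Fin (2 * N)) : ObjectProperty (NHomotopyCategory B N) :=
  if (i : ℕ) % 2 = 0 then F B N (s + (i / 2 : ℕ) + 1) (N - 2) else F B N (s + (i / 2 : ℕ)) 1

end NHomotopyCategory

/-!
The polygon is cut out of a single statement: if `r + r' + 1 = N`, then `(F_p^r, F_a^{r'})` with
`p = a + r'` is a stable t-structure (`isStableTStructure_F`), and all `F_s^r` with `r < N` are
triangulated (`isFullTriangulatedSubcategory_F`). Consecutive members of the polygon are the cases
`(r, r') = (N - 2, 1)` and `(r, r') = (1, N - 2)`, since `F_s^r` only depends on `s` modulo `N`.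

Monotone maps `P : ℤ ⥤ ℤ` with `P (i + N) = P i + N` act on `N`-complexes by precomposition
(`pull`), and this action preserves null-homotopic morphisms and degreewise split exact sequences.
Let `P` be the map which collapses the intervals `[b, b + r]`, `b ≡ s mod N`, to `b`. As `P ≤ id`,
the differentials give a natural morphism `P^* X ⟶ X`, and `X` lies in `F_s^r` if and only if this
is an isomorphism in the homotopy category (`F_quotient_iff`). In this form membership can be
propagated through triangles.

The triangulated input is elementary. A morphism `C(f) ⟶ W` amounts to a morphism `u : Y ⟶ W` and a
homotopy which trivializes `f ≫ u` (`coneDesc`, `cone_hom_ext`). This gives the exact sequences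
`Hom(ΣY, W) ⟶ Hom(ΣX, W) ⟶ Hom(C(f), W) ⟶ Hom(Y, W) ⟶ Hom(X, W)` in the homotopy category, hence
the five lemma for mapping cones (`isIso_quotient_coneMap`). Moreover, for a degreewise split
sequence `X ⟶ Y ⟶ Z`, the complex `Z` is isomorphic to the cone of `X ⟶ Y`
(`IsSplitSeq.isIso_coneToQuot`). Consequently, if `P^* ⟶ id` is an isomorphism at `X` and at `Y`, it
is one at `Z` (`IsSplitSeq.isCollapsed₃`). Closure of `F_s^r` under extensions follows by applying
this to `X ⟶ Y ⊞ C(id_X) ⟶ C(f)`, to `Y ⟶ C(f) ⟶ ΣX` and to `C(f) ⟶ C(Y ⟶ C(f)) ⟶ ΣY`; the last two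
cases also need `F_s^r` to be stable under desuspension, which comes from `Σ² X ≅ X[N]`
(`nonempty_iso_suspension_suspension`).

For the t-structure, `Hom(F_p^r, F_a^{r'}) = 0` because a morphism `f` has the explicit homotopy
`Xᵖ⁺ʳ = Xᵖ ⟶ Yᵖ = Yᵃ` given by `fᵖ` (`nullHomotopic_of_hasIdentities`). The triangle of `X` is
`P^* X ⟶ X ⟶ C`, where `P` collapses `[p, p + r]`. If `P'` collapses the complementary interval
`[a, p]`, then in each degree one of `P`, `P'` changes nothing, so the square formed by `P'^* P^* X`,
`P'^* X`, `P^* X` and `X` is degreewise split bicartesian. Hence `C` is isomorphic to the cone of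
`P'^* P^* X ⟶ P'^* X` (`nonempty_iso_cone_of_square`), and the latter lies in `F_a^{r'}`, being the
cone of a morphism between objects of `F_a^{r'}`.
-/

/-! ### Null-homotopic morphisms -/

namespace NComplex

section Homotopies

variable {B : Type u} [Category.{v} B] [Preadditive B] {N : ℕ}

/-- A family of morphisms `Xⁱ ⟶ Yⁱ⁻ᴺ⁺¹`, the data from which a null-homotopic morphism is
built. -/
abbrev HtpyFamily (X Y : NComplex B N) := ∀ i : ℤ, X.obj.obj i ⟶ Y.obj.obj (i - N + 1)

/-- The composite `Xᵐ ⟶ Xʲ ⟶ Yʲ⁻ᴺ⁺¹ ⟶ Yⁿ`, which is zero if one of the outer arrows would point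
backwards. -/
noncomputable def htpyTerm {X Y : NComplex B N} (s : HtpyFamily X Y) (m n j : ℤ) :
    X.obj.obj m ⟶ Y.obj.obj n :=
  tr X.obj m j ≫ s j ≫ tr Y.obj (j - N + 1) n

lemma htpyTerm_eq_zero {X Y : NComplex B N} (s : HtpyFamily X Y) {m n j : ℤ}
    (h : ¬ (m ≤ j ∧ j < m + N ∧ n ≤ j ∧ j < n + N)) : htpyTerm s m n j = 0 := by
  unfold htpyTerm
  by_cases h1 : m ≤ j
  · by_cases h2 : j < m + N
    · by_cases h3 : n ≤ j
      · rw [tr_of_not_le Y.obj (by omega), comp_zero, comp_zero]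
      · rw [tr_eq_zero Y.property (by omega), comp_zero, comp_zero]
    · rw [tr_eq_zero X.property (by omega), zero_comp]
  · rw [tr_of_not_le X.obj h1, zero_comp]

/-- Sums of the terms `htpyTerm s m n j` only depend on the part of the range where these do not
vanish for trivial reasons. -/
lemma sum_htpyTerm_congr {X Y : NComplex B N} (s : HtpyFamily X Y) {m n x y x' y' : ℤ}
    (h : ∀ j, m ≤ j → j < m + N → n ≤ j → j < n + N → (x ≤ j ∧ j < y ↔ x' ≤ j ∧ j < y')) :
    ∑ j ∈ Finset.Ico x y, htpyTerm s m n j = ∑ j ∈ Finset.Ico x' y', htpyTerm s m n j := by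
  rw [Finset.sum_subset (s₂ := Finset.Ico x y ∪ Finset.Ico x' y') Finset.subset_union_left,
    Finset.sum_subset (s₁ := Finset.Ico x' y') (s₂ := Finset.Ico x y ∪ Finset.Ico x' y')
      Finset.subset_union_right]
  · intro j _ hj'
    refine htpyTerm_eq_zero s fun hj => ?_
    have := h j hj.1 hj.2.1 hj.2.2.1 hj.2.2.2
    simp_all
  · intro j _ hj'
    refine htpyTerm_eq_zero s fun hj => ?_
    have := h j hj.1 hj.2.1 hj.2.2.1 hj.2.2.2
    simp_all

lemma tr_comp_htpyTerm {X Y : NComplex B N} (s : HtpyFamily X Y) {m m' n j : ℤ} (h : m ≤ m')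
    (h' : m' ≤ j) : tr X.obj m m' ≫ htpyTerm s m' n j = htpyTerm s m n j := by
  rw [htpyTerm, ← Category.assoc, tr_comp X.obj h h', htpyTerm]

lemma htpyTerm_comp_tr {X Y : NComplex B N} (s : HtpyFamily X Y) {m n n' j : ℤ} (h : n ≤ n')
    (h' : j < n + N) : htpyTerm s m n j ≫ tr Y.obj n n' = htpyTerm s m n' j := by
  rw [htpyTerm, Category.assoc, Category.assoc, tr_comp Y.obj (by omega) h, htpyTerm]

lemma tr_comp_sum {X Y : NComplex B N} (s : HtpyFamily X Y) {m m' n x y : ℤ} (h : m ≤ m')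
    (h' : m' ≤ x) : tr X.obj m m' ≫ ∑ j ∈ Finset.Ico x y, htpyTerm s m' n j =
      ∑ j ∈ Finset.Ico x y, htpyTerm s m n j := by
  rw [Preadditive.comp_sum]
  refine Finset.sum_congr rfl fun j hj => tr_comp_htpyTerm s h ?_
  rw [Finset.mem_Ico] at hj
  omega

lemma sum_comp_tr {X Y : NComplex B N} (s : HtpyFamily X Y) {m n n' x y : ℤ} (h : n ≤ n')
    (h' : y ≤ n + N) : (∑ j ∈ Finset.Ico x y, htpyTerm s m n j) ≫ tr Y.obj n n' =
      ∑ j ∈ Finset.Ico x y, htpyTerm s m n' j := by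
  rw [Preadditive.sum_comp]
  refine Finset.sum_congr rfl fun j hj => htpyTerm_comp_tr s h ?_
  rw [Finset.mem_Ico] at hj
  omega

lemma comp_htpyTerm {X Y Z : NComplex B N} (g : X ⟶ Y) (s : HtpyFamily Y Z) (m n j : ℤ) :
    g.hom.app m ≫ htpyTerm s m n j = htpyTerm (fun i => g.hom.app i ≫ s i) m n j := by
  simp only [htpyTerm, ← Category.assoc, tr_naturality]

/-- The null-homotopic morphism attached to a family of morphisms `Xⁱ ⟶ Yⁱ⁻ᴺ⁺¹`. -/
noncomputable def bd {X Y : NComplex B N} (s : HtpyFamily X Y) : X ⟶ Y :=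
  ObjectProperty.homMk
    { app := fun m => ∑ j ∈ Finset.Ico m (m + N), htpyTerm s m m j
      naturality := fun m n g => by
        have h := leOfHom g
        rw [map_eq_tr, map_eq_tr, sum_comp_tr s h le_rfl, tr_comp_sum s h le_rfl]
        exact sum_htpyTerm_congr s fun j _ _ _ _ => by omega }

lemma bd_app {X Y : NComplex B N} (s : HtpyFamily X Y) (m : ℤ) :
    (bd s).hom.app m = ∑ j ∈ Finset.Ico m (m + N), htpyTerm s m m j := rfl

lemma hom_ext {X Y : NComplex B N} {f g : X ⟶ Y} (h : ∀ m, f.hom.app m = g.hom.app m) :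
    f = g := by
  ext m
  exact h m

lemma nullHomotopic_iff {X Y : NComplex B N} (f : X ⟶ Y) :
    NullHomotopic f ↔ ∃ s : HtpyFamily X Y, f = bd s := by
  have key : ∀ (s : HtpyFamily X Y) (m : ℤ), ∑ j : Fin N,
      X.obj.map (homOfLE (show m ≤ m + (j : ℕ) by omega)) ≫ s (m + (j : ℕ)) ≫
        Y.obj.map (homOfLE (show m + (j : ℕ) - N + 1 ≤ m by omega)) = (bd s).hom.app m := by
    intro s m
    rw [bd_app, ← sum_fin_eq_sum_Ico]
    refine Finset.sum_congr rfl fun j _ => ?_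
    rw [map_eq_tr, map_eq_tr, htpyTerm]
  constructor
  · rintro ⟨s, hs⟩
    exact ⟨s, hom_ext fun m => (hs m).trans (key s m)⟩
  · rintro ⟨s, rfl⟩
    exact ⟨s, fun m => (key s m).symm⟩

lemma comp_bd {X Y Z : NComplex B N} (g : X ⟶ Y) (s : HtpyFamily Y Z) :
    g ≫ bd s = bd (fun i => g.hom.app i ≫ s i) := by
  refine hom_ext fun m => ?_
  change g.hom.app m ≫ (bd s).hom.app m = _
  simp only [bd_app, Preadditive.comp_sum, comp_htpyTerm]

lemma bd_add {X Y : NComplex B N} (s t : HtpyFamily X Y) :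
    bd (fun i => s i + t i) = bd s + bd t := by
  refine hom_ext fun m => ?_
  change _ = (bd s).hom.app m + (bd t).hom.app m
  simp only [bd_app, ← Finset.sum_add_distrib, htpyTerm, Preadditive.add_comp,
    Preadditive.comp_add]

/-- A morphism is null-homotopic if it factors, on each interval `[c - N + 1, c]` with `c` in a
fixed residue class modulo `N`, through a morphism `h c : Xᶜ ⟶ Yᶜ⁻ᴺ⁺¹`. -/
lemma nullHomotopic_of_factors {X Y : NComplex B N} (f : X ⟶ Y) (b : ℤ) (hN : 0 < N)
    (h : HtpyFamily X Y)
    (hf : ∀ c m : ℤ, (N : ℤ) ∣ c - b → c - N + 1 ≤ m → m ≤ c →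
      f.hom.app m = htpyTerm h m m c) : NullHomotopic f := by
  classical
  rw [nullHomotopic_iff]
  refine ⟨fun i => if (N : ℤ) ∣ i - b then h i else 0, hom_ext fun m => ?_⟩
  -- the only element of `[m, m + N)` congruent to `b` modulo `N`
  obtain ⟨c, hc, h1, h2⟩ : ∃ c : ℤ, (N : ℤ) ∣ c - b ∧ m ≤ c ∧ c < m + N := by
    refine ⟨m + (b - m) % N, ?_, ?_, ?_⟩
    · have : m + (b - m) % N - b = -((b - m) - (b - m) % N) := by ring
      rw [this]
      exact (Int.dvd_self_sub_emod).neg_right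
    · have := Int.emod_nonneg (b - m) (show (N : ℤ) ≠ 0 by omega)
      omega
    · have := Int.emod_lt_of_pos (b - m) (show 0 < (N : ℤ) by omega)
      omega
  rw [bd_app, Finset.sum_eq_single c, hf c m hc (by omega) h1]
  · simp only [htpyTerm, if_pos hc]
  · intro j hj hjc
    rw [Finset.mem_Ico] at hj
    have : ¬ (N : ℤ) ∣ j - b := fun hd => hjc <| by
      have hd' : (N : ℤ) ∣ j - c := by simpa using dvd_sub hd hc
      have := Int.eq_zero_of_abs_lt_dvd hd' (by rw [abs_lt]; omega)
      omega
    simp only [htpyTerm, if_neg this, zero_comp, comp_zero]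
  · intro hc'
    exact absurd (Finset.mem_Ico.2 ⟨h1, h2⟩) hc'

/-- The component `Xᵃ ⟶ Wᵐ` of the morphism `C(f) ⟶ W` attached to a morphism `Y ⟶ W` and a
homotopy `s`. -/
noncomputable def descEntry {X W : NComplex B N} (s : HtpyFamily X W) (m a : ℤ) :
    X.obj.obj a ⟶ W.obj.obj m :=
  ∑ j ∈ Finset.Ico a (m + N), htpyTerm s a m j

lemma sum_Ico_split {M : Type*} [AddCommMonoid M] (g : ℤ → M) {x y z : ℤ} (hxy : x ≤ y)
    (hyz : y ≤ z) :
    ∑ j ∈ Finset.Ico x z, g j = ∑ j ∈ Finset.Ico x y, g j + ∑ j ∈ Finset.Ico y z, g j := by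
  rw [← Finset.sum_union (Finset.Ico_disjoint_Ico_consecutive x y z),
    Finset.Ico_union_Ico_eq_Ico hxy hyz]

/-- The identity which makes the morphisms with components `u` and `descEntry s` commute with the
differentials. -/
lemma descEntry_comp_tr {X Y W : NComplex B N} {f : X ⟶ Y} {u : Y ⟶ W}
    {s : HtpyFamily X W} (hs : f ≫ u = bd s)
    {m n a : ℤ} (hmn : m ≤ n) (ha : a ∈ Finset.Ioo m (m + (N : ℤ))) :
    descEntry s m a ≫ tr W.obj m n = coneEntry N f.hom m n a ≫ u.hom.app n +
      ((if a ∈ Finset.Ioo n (n + (N : ℤ)) then descEntry s n a else 0) -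
        (if m + (N : ℤ) ∈ Finset.Ioo n (n + (N : ℤ)) then
          tr X.obj a (m + N) ≫ descEntry s n (m + N) else 0)) := by
  have hu : f.hom.app n ≫ u.hom.app n = ∑ j ∈ Finset.Ico n (n + (N : ℤ)), htpyTerm s n n j :=
    congr_arg (fun g => g.hom.app n) hs
  rw [Finset.mem_Ioo] at ha
  simp only [Finset.mem_Ioo, coneEntry, ite_comp, zero_comp, Category.assoc, hu]
  have e1 : descEntry s m a ≫ tr W.obj m n = ∑ j ∈ Finset.Ico a (m + (N : ℤ)), htpyTerm s a n j :=
    sum_comp_tr s hmn le_rfl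
  have e2 : tr X.obj a (m + N) ≫ descEntry s n (m + N) =
      ∑ j ∈ Finset.Ico (m + (N : ℤ)) (n + N), htpyTerm s a n j :=
    tr_comp_sum s (by omega) le_rfl
  rw [e1, e2, descEntry]
  have e3 : (if n < m + (N : ℤ) ∧ m + (N : ℤ) < n + N then
      ∑ j ∈ Finset.Ico (m + (N : ℤ)) (n + N), htpyTerm s a n j else 0) =
      if n < m + N then ∑ j ∈ Finset.Ico (m + (N : ℤ)) (n + N), htpyTerm s a n j else 0 := by
    by_cases h : m = n
    · subst h
      simp
    · congr 1
      rw [eq_iff_iff]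
      omega
  rw [e3]
  by_cases hn : n < m + N
  · rw [if_pos hn, if_pos hn]
    have hsplit : ∀ x, x ≤ m + N → ∑ j ∈ Finset.Ico x (n + (N : ℤ)), htpyTerm s a n j =
        ∑ j ∈ Finset.Ico x (m + (N : ℤ)), htpyTerm s a n j +
          ∑ j ∈ Finset.Ico (m + (N : ℤ)) (n + N), htpyTerm s a n j := fun x hx =>
      sum_Ico_split _ hx (by omega)
    by_cases han : n < a
    · rw [tr_of_not_le X.obj (show ¬ a ≤ n by omega), zero_comp, zero_add, if_pos (by omega),
        hsplit a (by omega), add_sub_cancel_right]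
    · rw [if_neg (by omega), tr_comp_sum s (by omega) le_rfl, hsplit n hn.le, zero_sub,
        add_neg_cancel_right]
      exact sum_htpyTerm_congr s fun j _ _ _ _ => by omega
  · rw [if_neg hn, if_neg hn, if_neg (by omega), sub_zero, add_zero]
    refine Finset.sum_eq_zero fun j hj => htpyTerm_eq_zero s ?_
    rw [Finset.mem_Ico] at hj
    omega

end Homotopies

end NComplex

/-! ### Morphisms out of mapping cones -/

namespace NComplex

section ConeMaps

variable {B : Type u} [Category.{v} B] [Preadditive B] {N : ℕ} [HasFiniteBiproducts B]

attribute [local instance] hasBinaryBiproducts_of_finite_biproducts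

variable {X Y X' Y' W W' : NComplex B N}

/-- The inclusion of the summand `Xᵃ` of `(ΣX)ᵐ`. -/
noncomputable def suspι (X : NComplex B N) (m a : ℤ) (h : a ∈ Finset.Ioo m (m + (N : ℤ))) :
    X.obj.obj a ⟶ ((suspension B N).obj X).obj.obj m :=
  biproduct.ι (fun i : Finset.Ioo m (m + (N : ℤ)) => X.obj.obj i) ⟨a, h⟩

lemma susp_hom_ext {m : ℤ} {Z : B} {φ ψ : ((suspension B N).obj X).obj.obj m ⟶ Z}
    (h : ∀ a ha, suspι X m a ha ≫ φ = suspι X m a ha ≫ ψ) : φ = ψ :=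
  biproduct.hom_ext' _ _ fun a => h a.1 a.2

lemma suspι_map (f : X ⟶ Y) (m a : ℤ) (h : a ∈ Finset.Ioo m (m + (N : ℤ))) :
    suspι X m a h ≫ ((suspension B N).map f).hom.app m = f.hom.app a ≫ suspι Y m a h :=
  biproduct.ι_map (f := fun i : Finset.Ioo m (m + (N : ℤ)) => X.obj.obj i)
    (g := fun i : Finset.Ioo m (m + (N : ℤ)) => Y.obj.obj i) (fun i => f.hom.app i) ⟨a, h⟩

/-- The morphism `(ΣX)ᵐ ⟶ Z` with given components. -/
noncomputable def suspDescApp (m : ℤ) {Z : B} (φ : ∀ a : ℤ, X.obj.obj a ⟶ Z) :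
    ((suspension B N).obj X).obj.obj m ⟶ Z :=
  biproduct.desc (f := fun i : Finset.Ioo m (m + (N : ℤ)) => X.obj.obj i) fun a => φ a

@[simp] lemma suspι_descApp (m : ℤ) {Z : B} (φ : ∀ a : ℤ, X.obj.obj a ⟶ Z) (a : ℤ) (h) :
    suspι X m a h ≫ suspDescApp m φ = φ a :=
  biproduct.ι_desc _ _

@[simp] lemma suspι_descApp_assoc (m : ℤ) {Z Z' : B} (φ : ∀ a : ℤ, X.obj.obj a ⟶ Z) (a : ℤ) (h)
    (g : Z ⟶ Z') : suspι X m a h ≫ suspDescApp m φ ≫ g = φ a ≫ g := by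
  rw [← Category.assoc, suspι_descApp]

lemma suspι_susp_map_comp {m n a c : ℤ} (h) {Z : B} (g : m ⟶ n) (hc : m + (N : ℤ) = c)
    (φ : ((suspension B N).obj X).obj.obj n ⟶ Z) :
    suspι X m a h ≫ ((suspension B N).obj X).obj.map g ≫ φ =
      (if ha : a ∈ Finset.Ioo n (n + (N : ℤ)) then suspι X n a ha ≫ φ else 0) -
        (if hm : c ∈ Finset.Ioo n (n + (N : ℤ)) then
          tr X.obj a c ≫ suspι X n c hm ≫ φ else 0) := by
  subst hc
  let ψ : ∀ b, X.obj.obj b ⟶ Z := fun b =>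
    if hb : b ∈ Finset.Ioo n (n + (N : ℤ)) then suspι X n b hb ≫ φ else 0
  have h1 : suspι X m a h ≫ ((suspension B N).obj X).obj.map g ≫ φ =
      ∑ b : Finset.Ioo n (n + (N : ℤ)), suspEntry N X.obj m a b ≫ ψ b := by
    have key : ∀ φ' : (⨁ fun i : Finset.Ioo n (n + (N : ℤ)) => X.obj.obj i) ⟶ Z,
        biproduct.ι (fun i : Finset.Ioo m (m + (N : ℤ)) => X.obj.obj i) ⟨a, h⟩ ≫
          biproduct.matrix (fun (a : Finset.Ioo m (m + (N : ℤ)))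
            (b : Finset.Ioo n (n + (N : ℤ))) => suspEntry N X.obj m a b) ≫ φ' =
        ∑ b : Finset.Ioo n (n + (N : ℤ)), suspEntry N X.obj m a b ≫
          biproduct.ι (fun i : Finset.Ioo n (n + (N : ℤ)) => X.obj.obj i) b ≫ φ' := by
      intro φ'
      rw [biproduct.ι_matrix_assoc, biproduct.lift_eq, Preadditive.sum_comp]
      simp only [Category.assoc]
    refine (key φ).trans (Finset.sum_congr rfl fun b _ => ?_)
    simp only [ψ, dif_pos b.2]
    rfl
  rw [h1, sum_suspEntry]
  by_cases ha : a ∈ Finset.Ioo n (n + (N : ℤ)) <;>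
    by_cases hm : m + (N : ℤ) ∈ Finset.Ioo n (n + (N : ℤ)) <;>
    simp only [ψ, if_pos, if_neg, dif_pos, dif_neg, ha, hm, not_false_eq_true]

/-- The inclusion of the graded object underlying `ΣX` into the one underlying `C(f)`. -/
noncomputable def coneInr (f : X ⟶ Y) (m : ℤ) :
    ((suspension B N).obj X).obj.obj m ⟶ (cone f).obj.obj m :=
  (biprod.inr : (suspDiagram X.property).obj m ⟶ Y.obj.obj m ⊞ (suspDiagram X.property).obj m)

/-- The projection of the graded object underlying `C(f)` to the one underlying `Y`. -/
noncomputable def coneFst (f : X ⟶ Y) (m : ℤ) : (cone f).obj.obj m ⟶ Y.obj.obj m :=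
  (biprod.fst : Y.obj.obj m ⊞ (suspDiagram X.property).obj m ⟶ Y.obj.obj m)

@[simp]
lemma coneInl_fst (f : X ⟶ Y) (m : ℤ) : (coneInl f).hom.app m ≫ coneFst f m = 𝟙 _ :=
  biprod.inl_fst

@[simp]
lemma coneInl_snd_app (f : X ⟶ Y) (m : ℤ) :
    (coneInl f).hom.app m ≫ (coneSnd f).hom.app m = 0 :=
  biprod.inl_snd

@[simp]
lemma coneInr_fst (f : X ⟶ Y) (m : ℤ) : coneInr f m ≫ coneFst f m = 0 :=
  biprod.inr_fst

@[simp]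
lemma coneInr_snd (f : X ⟶ Y) (m : ℤ) : coneInr f m ≫ (coneSnd f).hom.app m = 𝟙 _ :=
  biprod.inr_snd

lemma cone_total (f : X ⟶ Y) (m : ℤ) :
    coneFst f m ≫ (coneInl f).hom.app m + (coneSnd f).hom.app m ≫ coneInr f m = 𝟙 _ :=
  biprod.total

@[simp]
lemma coneInl_snd (f : X ⟶ Y) : coneInl f ≫ coneSnd f = 0 :=
  hom_ext fun m => coneInl_snd_app f m

lemma cone_app_ext {f : X ⟶ Y} {m : ℤ} {Z : B} {φ ψ : (cone f).obj.obj m ⟶ Z}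
    (h : (coneInl f).hom.app m ≫ φ = (coneInl f).hom.app m ≫ ψ)
    (h' : coneInr f m ≫ φ = coneInr f m ≫ ψ) : φ = ψ :=
  biprod.hom_ext' _ _ h h'

lemma suspι_coneInr_map_comp (f : X ⟶ Y) {m n : ℤ} (g : m ⟶ n) (a : ℤ) (h) {Z : B}
    (φ : (cone f).obj.obj n ⟶ Z) :
    suspι X m a h ≫ coneInr f m ≫ (cone f).obj.map g ≫ φ =
      coneEntry N f.hom m n a ≫ (coneInl f).hom.app n ≫ φ +
        suspι X m a h ≫ ((suspension B N).obj X).obj.map g ≫ coneInr f n ≫ φ := by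
  have h1 : (biprod.inr : (suspDiagram X.property).obj m ⟶
      Y.obj.obj m ⊞ (suspDiagram X.property).obj m) ≫
      biprod.desc (Y.obj.map g ≫ biprod.inl)
        (biprod.lift (coneComponent f m n) ((suspDiagram X.property).map g)) =
      coneComponent f m n ≫ biprod.inl + (suspDiagram X.property).map g ≫ biprod.inr := by
    rw [biprod.inr_desc, biprod.lift_eq]
  let c : ((suspension B N).obj X).obj.obj m ⟶ Y.obj.obj n := coneComponent f m n
  have h2 : suspι X m a h ≫ c = coneEntry N f.hom m n a :=
    biproduct.ι_desc _ _
  have h3 : coneInr f m ≫ (cone f).obj.map g =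
      c ≫
        (coneInl f).hom.app n + ((suspension B N).obj X).obj.map g ≫ coneInr f n := h1
  rw [← Category.assoc (coneInr f m), h3, Preadditive.add_comp, Preadditive.comp_add,
    Category.assoc, Category.assoc, ← Category.assoc _ c, h2]

/-- The morphism `C(f)ᵐ ⟶ Z` with given components. -/
noncomputable def coneDescApp (f : X ⟶ Y) {m : ℤ} {Z : B} (u : Y.obj.obj m ⟶ Z)
    (φ : ((suspension B N).obj X).obj.obj m ⟶ Z) : (cone f).obj.obj m ⟶ Z :=
  coneFst f m ≫ u + (coneSnd f).hom.app m ≫ φ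

@[simp] lemma coneInl_descApp (f : X ⟶ Y) {m : ℤ} {Z : B} (u : Y.obj.obj m ⟶ Z)
    (φ : ((suspension B N).obj X).obj.obj m ⟶ Z) :
    (coneInl f).hom.app m ≫ coneDescApp f u φ = u := by
  rw [coneDescApp, Preadditive.comp_add, ← Category.assoc, ← Category.assoc, coneInl_fst,
    coneInl_snd_app, zero_comp, add_zero, Category.id_comp]

@[simp] lemma coneInr_descApp (f : X ⟶ Y) {m : ℤ} {Z : B} (u : Y.obj.obj m ⟶ Z)
    (φ : ((suspension B N).obj X).obj.obj m ⟶ Z) :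
    coneInr f m ≫ coneDescApp f u φ = φ := by
  rw [coneDescApp, Preadditive.comp_add, ← Category.assoc, ← Category.assoc, coneInr_fst,
    coneInr_snd, zero_comp, zero_add, Category.id_comp]

/-- The morphism `C(f) ⟶ W` attached to a morphism `u : Y ⟶ W` and a family `s` which exhibits
`f ≫ u` as null-homotopic. -/
noncomputable def coneDesc {f : X ⟶ Y} (u : Y ⟶ W) (s : HtpyFamily X W) (hs : f ≫ u = bd s) :
    cone f ⟶ W :=
  ObjectProperty.homMk
    { app := fun m => coneDescApp f (u.hom.app m) (suspDescApp m (fun a => descEntry s m a))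
      naturality := fun m n g => by
        refine cone_app_ext ?_ ?_
        · rw [← Category.assoc, ← (coneInl f).hom.naturality, Category.assoc, coneInl_descApp,
            ← Category.assoc, coneInl_descApp, u.hom.naturality]
        · refine susp_hom_ext fun a ha => ?_
          rw [suspι_coneInr_map_comp, suspι_susp_map_comp _ g rfl, ← Category.assoc _ _ (W.obj.map g)]
          simp only [coneInl_descApp, coneInr_descApp, suspι_descApp, suspι_descApp_assoc,
            dite_eq_ite]
          rw [map_eq_tr, descEntry_comp_tr hs (leOfHom g) ha] }

lemma coneInl_desc {f : X ⟶ Y} (u : Y ⟶ W) (s : HtpyFamily X W) (hs : f ≫ u = bd s) :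
    coneInl f ≫ coneDesc u s hs = u :=
  hom_ext fun _ => coneInl_descApp f _ _

lemma mem_top (hN : 2 ≤ N) (i : ℤ) : i ∈ Finset.Ioo (i - N + 1) (i - N + 1 + (N : ℤ)) := by
  rw [Finset.mem_Ioo]
  omega

/-- The family of morphisms `Xⁱ ⟶ Wⁱ⁻ᴺ⁺¹` attached to a morphism `ΣX ⟶ W`: its restriction to the
last summand of `(ΣX)ⁱ⁻ᴺ⁺¹`. -/
noncomputable def suspFamily (hN : 2 ≤ N) (φ : (suspension B N).obj X ⟶ W) : HtpyFamily X W :=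
  fun i => suspι X (i - N + 1) i (mem_top hN i) ≫ φ.hom.app _

/-- The family of morphisms `Xⁱ ⟶ Wⁱ⁻ᴺ⁺¹` attached to a morphism `C(f) ⟶ W`. -/
noncomputable def coneFamily (hN : 2 ≤ N) {f : X ⟶ Y} (v : cone f ⟶ W) : HtpyFamily X W :=
  fun i => suspι X (i - N + 1) i (mem_top hN i) ≫ coneInr f _ ≫ v.hom.app _

lemma coneFamily_desc (hN : 2 ≤ N) {f : X ⟶ Y} (u : Y ⟶ W) (s : HtpyFamily X W)
    (hs : f ≫ u = bd s) : coneFamily hN (coneDesc u s hs) = s := by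
  funext i
  have h : coneInr f (i - N + 1) ≫ (coneDesc u s hs).hom.app (i - N + 1) =
      suspDescApp (i - N + 1) (fun a => descEntry s (i - N + 1) a) := coneInr_descApp f _ _
  rw [coneFamily, h, suspι_descApp, descEntry, Finset.sum_eq_single i]
  · rw [htpyTerm, tr_self, tr_self, Category.id_comp, Category.comp_id]
  · intro j hj hj'
    rw [Finset.mem_Ico] at hj
    omega
  · intro hi
    rw [Finset.mem_Ico] at hi
    omega

/-- The restriction of a morphism `C(f) ⟶ W` to the summands of `ΣX` is determined by its
restrictions to the last summands: the differentials of `C(f)` carry the last summand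
`Xᵃ` in degree `a - N + 1` to the summands `Xᵃ` and `Xᵃ⁺¹` in higher degrees. -/
lemma cone_component_eq (hN : 2 ≤ N) {f : X ⟶ Y} (v : cone f ⟶ W) {m a : ℤ}
    (ha : a ∈ Finset.Ioo m (m + (N : ℤ))) :
    suspι X m a ha ≫ coneInr f m ≫ v.hom.app m = descEntry (coneFamily hN v) m a := by
  have step : ∀ (a : ℤ) (ha : a ∈ Finset.Ioo m (m + (N : ℤ))),
      suspι X m a ha ≫ coneInr f m ≫ v.hom.app m = htpyTerm (coneFamily hN v) a m a +
        if ha' : a + 1 ∈ Finset.Ioo m (m + (N : ℤ)) then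
          tr X.obj a (a + 1) ≫ suspι X m (a + 1) ha' ≫ coneInr f m ≫ v.hom.app m else 0 := by
    intro a ha
    have ha' := Finset.mem_Ioo.1 ha
    have h := suspι_coneInr_map_comp f (homOfLE (show a - N + 1 ≤ m by omega)) a (mem_top hN a)
      (v.hom.app m)
    rw [suspι_susp_map_comp _ _ (show a - (N : ℤ) + 1 + N = a + 1 by ring), coneEntry, tr_of_not_le X.obj (show ¬ a ≤ m by omega), zero_comp,
      ite_self, zero_comp, zero_add, dif_pos ha, v.hom.naturality, map_eq_tr W.obj] at h
    have h' : htpyTerm (coneFamily hN v) a m a = suspι X (a - N + 1) a (mem_top hN a) ≫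
        coneInr f _ ≫ v.hom.app _ ≫ tr W.obj (a - N + 1) m := by
      simp only [htpyTerm, tr_self, Category.id_comp, coneFamily, Category.assoc]
    rw [h', h, sub_add_cancel]
  have main : ∀ (k : ℕ) (a : ℤ) (ha : a ∈ Finset.Ioo m (m + (N : ℤ))), m + N - 1 - a = k →
      suspι X m a ha ≫ coneInr f m ≫ v.hom.app m = descEntry (coneFamily hN v) m a := by
    intro k
    induction k with
    | zero =>
      intro a ha hk
      have ha' := Finset.mem_Ioo.1 ha
      rw [step a ha, dif_neg (by rw [Finset.mem_Ioo]; omega), add_zero, descEntry,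
        sum_Ico_split _ (show a ≤ a + 1 by omega) (show a + 1 ≤ m + N by omega),
        Finset.Ico_eq_empty (a := a + 1) (by omega), Finset.sum_empty, add_zero,
        ← Order.succ_eq_add_one, Finset.Ico_succ_right_eq_Icc, Finset.Icc_self,
        Finset.sum_singleton]
    | succ k ih =>
      intro a ha hk
      have ha' := Finset.mem_Ioo.1 ha
      have ha1 : a + 1 ∈ Finset.Ioo m (m + (N : ℤ)) := by rw [Finset.mem_Ioo]; omega
      rw [step a ha, dif_pos ha1, ih (a + 1) ha1 (by push_cast at hk; omega), descEntry,
        tr_comp_sum _ (by omega) le_rfl, descEntry,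
        sum_Ico_split _ (show a ≤ a + 1 by omega) (show a + 1 ≤ m + N by omega)]
      congr 1
      rw [← Order.succ_eq_add_one, Finset.Ico_succ_right_eq_Icc, Finset.Icc_self,
        Finset.sum_singleton]
  have ha' := Finset.mem_Ioo.1 ha
  exact main (m + N - 1 - a).toNat a ha (by omega)

/-- A morphism out of a mapping cone is determined by its restriction to `Y` and its attached
family. -/
lemma cone_hom_ext (hN : 2 ≤ N) {f : X ⟶ Y} {v w : cone f ⟶ W}
    (h : coneInl f ≫ v = coneInl f ≫ w) (h' : coneFamily hN v = coneFamily hN w) : v = w := by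
  refine hom_ext fun m => cone_app_ext (congr_arg (fun g => g.hom.app m) h) ?_
  refine susp_hom_ext fun a ha => ?_
  rw [cone_component_eq hN v ha, cone_component_eq hN w ha, h']

lemma coneFamily_snd_comp (hN : 2 ≤ N) (f : X ⟶ Y) (φ : (suspension B N).obj X ⟶ W) :
    coneFamily hN (coneSnd f ≫ φ) = suspFamily hN φ := by
  funext i
  have h : coneInr f (i - N + 1) ≫ (coneSnd f ≫ φ).hom.app (i - N + 1) =
      φ.hom.app (i - N + 1) := by
    change coneInr f (i - N + 1) ≫ (coneSnd f).hom.app (i - N + 1) ≫ φ.hom.app (i - N + 1) = _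
    rw [← Category.assoc, coneInr_snd, Category.id_comp]
  rw [coneFamily, suspFamily, h]

/-- The family attached to a morphism `C(f) ⟶ W` exhibits the composite `X ⟶ Y ⟶ C(f) ⟶ W` as
null-homotopic. -/
lemma bd_coneFamily (hN : 2 ≤ N) {f : X ⟶ Y} (v : cone f ⟶ W) :
    f ≫ coneInl f ≫ v = bd (coneFamily hN v) := by
  refine hom_ext fun m => ?_
  have hm : m ∈ Finset.Ioo (m - 1) (m - 1 + (N : ℤ)) := by rw [Finset.mem_Ioo]; omega
  have hm' : m + N - 1 ∈ Finset.Ioo m (m + (N : ℤ)) := by rw [Finset.mem_Ioo]; omega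
  have hm'' : m ∉ Finset.Ioo m (m + (N : ℤ)) := by rw [Finset.mem_Ioo]; omega
  have h := suspι_coneInr_map_comp f (homOfLE (show m - 1 ≤ m by omega)) m hm (v.hom.app m)
  rw [suspι_susp_map_comp _ _ (show m - 1 + (N : ℤ) = m + N - 1 by ring), dif_pos hm',
    dif_neg hm'', cone_component_eq hN v hm', zero_sub, v.hom.naturality, map_eq_tr W.obj,
    ← Category.assoc (coneInr f _), ← Category.assoc (suspι _ _ _ _),
    cone_component_eq hN v hm, descEntry, sum_comp_tr _ (by omega) le_rfl, descEntry,
    tr_comp_sum _ (by omega) le_rfl, coneEntry, if_pos (by omega), tr_self, Category.id_comp] at h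
  change f.hom.app m ≫ (coneInl f).hom.app m ≫ v.hom.app m = _
  rw [bd_app, sum_Ico_split _ (show m ≤ m + N - 1 by omega) (show m + N - 1 ≤ m + N by omega),
    ← sub_eq_iff_eq_add, sub_eq_add_neg, ← h]
  congr 2
  ring

/-- The family `C(f)ⁱ ⟶ Yⁱ ⟶ Wⁱ⁻ᴺ⁺¹` attached to a family `Yⁱ ⟶ Wⁱ⁻ᴺ⁺¹`. -/
noncomputable def fstFamily (f : X ⟶ Y) (t : HtpyFamily Y W) : HtpyFamily (cone f) W :=
  fun i => coneFst f i ≫ t i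

lemma coneInl_bd_fstFamily (f : X ⟶ Y) (t : HtpyFamily Y W) :
    coneInl f ≫ bd (fstFamily f t) = bd t := by
  rw [comp_bd]
  congr 1
  funext i
  rw [fstFamily, ← Category.assoc, coneInl_fst, Category.id_comp]

/-- Only the last term of the null-homotopic morphism attached to `fstFamily f t` contributes on
the last summand of `ΣX`. -/
lemma coneFamily_bd_fstFamily (hN : 2 ≤ N) (f : X ⟶ Y) (t : HtpyFamily Y W) :
    coneFamily hN (bd (fstFamily f t)) = fun i => f.hom.app i ≫ t i := by
  funext i
  have hj : ∀ j, i - N + 1 ≤ j → suspι X (i - N + 1) i (mem_top hN i) ≫ coneInr f (i - N + 1) ≫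
      htpyTerm (fstFamily f t) (i - N + 1) (i - N + 1) j =
      coneEntry N f.hom (i - N + 1) j i ≫ t j ≫ tr W.obj (j - N + 1) (i - N + 1) := by
    intro j hj
    have h := suspι_coneInr_map_comp f (homOfLE hj) i (mem_top hN i)
      (coneFst f j ≫ t j ≫ tr W.obj (j - N + 1) (i - N + 1))
    rw [← Category.assoc (coneInl f |>.hom.app j), coneInl_fst, ← Category.assoc (coneInr f j),
      coneInr_fst, zero_comp, comp_zero, comp_zero, add_zero, Category.id_comp, map_eq_tr] at h
    rw [htpyTerm, fstFamily, Category.assoc]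
    exact h
  rw [coneFamily, bd_app, Preadditive.comp_sum, Preadditive.comp_sum, Finset.sum_eq_single i]
  · rw [hj i (by omega), coneEntry, if_pos (by omega), tr_self, tr_self, Category.id_comp,
      Category.comp_id]
  · intro j h hji
    rw [Finset.mem_Ico] at h
    rw [hj j h.1, coneEntry, tr_of_not_le X.obj (by omega), zero_comp, ite_self, zero_comp]
  · intro hi
    rw [Finset.mem_Ico] at hi
    omega

end ConeMaps

end NComplex

/-! ### Exact sequences and the five lemma -/

namespace NComplex

section Exactness

variable {B : Type u} [Category.{v} B] [Preadditive B] {N : ℕ}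

local notation "Q" => NHomotopyCategory.quotient B N

instance quotient_additive : (Q).Additive where
  map_add := rfl

lemma quotient_map_eq_zero_iff {X Y : NComplex B N} (f : X ⟶ Y) :
    (Q).map f = 0 ↔ NullHomotopic f := by
  rw [← (Q).map_zero X Y, Quotient.functor_map_eq_iff]
  change NullHomotopic (f - 0) ↔ _
  rw [sub_zero]

lemma quotient_map_bd {X Y : NComplex B N} (s : HtpyFamily X Y) : (Q).map (bd s) = 0 :=
  (quotient_map_eq_zero_iff _).2 ((nullHomotopic_iff _).2 ⟨s, rfl⟩)

lemma exists_bd_of_quotient_map_eq_zero {X Y : NComplex B N} {f : X ⟶ Y} (h : (Q).map f = 0) :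
    ∃ s : HtpyFamily X Y, f = bd s :=
  (nullHomotopic_iff _).1 ((quotient_map_eq_zero_iff _).1 h)

/-- A sequence `X ⟶ Y ⟶ Z` of `N`-complexes is split if it is a split short exact sequence in each
degree. -/
def IsSplitSeq {X Y Z : NComplex B N} (i : X ⟶ Y) (p : Y ⟶ Z) : Prop :=
  ∀ m : ℤ, ∃ (r : Y.obj.obj m ⟶ X.obj.obj m) (t : Z.obj.obj m ⟶ Y.obj.obj m),
    i.hom.app m ≫ r = 𝟙 _ ∧ t ≫ p.hom.app m = 𝟙 _ ∧ r ≫ i.hom.app m + p.hom.app m ≫ t = 𝟙 _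

namespace IsSplitSeq

variable {X Y Z W : NComplex B N} {i : X ⟶ Y} {p : Y ⟶ Z} (h : IsSplitSeq i p)
include h

lemma comp_eq_zero : i ≫ p = 0 := by
  refine hom_ext fun m => ?_
  obtain ⟨r, t, h1, h2, h3⟩ := h m
  have h4 : i.hom.app m ≫ p.hom.app m ≫ t = 0 := by
    have := congr_arg (fun x => i.hom.app m ≫ x) h3
    simpa [reassoc_of% h1] using this
  change i.hom.app m ≫ p.hom.app m = 0
  rw [← Category.comp_id (p.hom.app m), ← h2, reassoc_of% h4, zero_comp]

lemma epi_ext {φ ψ : Z ⟶ W} (h' : p ≫ φ = p ≫ ψ) : φ = ψ := by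
  refine hom_ext fun m => ?_
  obtain ⟨r, t, h1, h2, h3⟩ := h m
  have h4 : p.hom.app m ≫ φ.hom.app m = p.hom.app m ≫ ψ.hom.app m :=
    congr_arg (fun g => g.hom.app m) h'
  rw [← Category.id_comp (φ.hom.app m), ← h2, Category.assoc, h4, reassoc_of% h2]

lemma exists_desc (v : Y ⟶ W) (hv : i ≫ v = 0) : ∃ w : Z ⟶ W, p ≫ w = v := by
  choose r t h1 h2 h3 using h
  have hv' : ∀ m, i.hom.app m ≫ v.hom.app m = 0 := fun m =>
    congr_arg (fun g => g.hom.app m) hv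
  have hp : ∀ m, p.hom.app m ≫ t m ≫ v.hom.app m = v.hom.app m := fun m => by
    have := congr_arg (fun x => x ≫ v.hom.app m) (h3 m)
    simpa [hv'] using this
  refine ⟨ObjectProperty.homMk
    { app := fun m => t m ≫ v.hom.app m
      naturality := fun m n g => ?_ }, hom_ext hp⟩
  have h4 : p.hom.app m ≫ Z.obj.map g ≫ t n ≫ v.hom.app n =
      p.hom.app m ≫ (t m ≫ v.hom.app m) ≫ W.obj.map g := by
    rw [← p.hom.naturality_assoc, hp, Category.assoc, reassoc_of% (hp m), v.hom.naturality]
  rw [← Category.id_comp (Z.obj.map g ≫ t n ≫ v.hom.app n), ← h2, Category.assoc, h4,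
    reassoc_of% (h2 m), Category.assoc]

lemma exists_extension (s : HtpyFamily X W) : ∃ s' : HtpyFamily Y W, i ≫ bd s' = bd s := by
  choose r t h1 h2 h3 using h
  refine ⟨fun j => r j ≫ s j, ?_⟩
  rw [comp_bd]
  congr 1
  funext j
  rw [reassoc_of% (h1 j)]

/-- The contravariant functors `Hom(-, W)` of the homotopy category are half exact on split
sequences. -/
lemma exists_quotient_desc (v : (Q).obj Y ⟶ (Q).obj W) (hv : (Q).map i ≫ v = 0) :
    ∃ w : (Q).obj Z ⟶ (Q).obj W, (Q).map p ≫ w = v := by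
  obtain ⟨v, rfl⟩ := (Q).map_surjective v
  rw [← (Q).map_comp] at hv
  obtain ⟨s, hs⟩ := exists_bd_of_quotient_map_eq_zero hv
  obtain ⟨s', hs'⟩ := h.exists_extension s
  obtain ⟨w, hw⟩ := h.exists_desc (v - bd s') (by rw [Preadditive.comp_sub, hs, hs', sub_self])
  refine ⟨(Q).map w, ?_⟩
  rw [← (Q).map_comp, hw, (Q).map_sub, quotient_map_bd, sub_zero]

/-- If the kernel `X` is contractible, then `p` is an isomorphism in the homotopy category:
the contraction of `X` extends to a retraction of `i`. -/
lemma isIso_quotient_map (hX : NullHomotopic (𝟙 X)) : IsIso ((Q).map p) := by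
  obtain ⟨s, hs⟩ := (nullHomotopic_iff _).1 hX
  obtain ⟨s', hs'⟩ := h.exists_extension s
  obtain ⟨w, hw⟩ := h.exists_desc (𝟙 Y - bd s' ≫ i) (by
    rw [Preadditive.comp_sub, ← Category.assoc, hs', ← hs, Category.comp_id, Category.id_comp,
      sub_self])
  refine ⟨(Q).map w, ?_, ?_⟩
  · rw [← (Q).map_comp, hw, (Q).map_sub, (Q).map_comp, quotient_map_bd, zero_comp, sub_zero,
      (Q).map_id]
  · rw [← (Q).map_comp, ← (Q).map_id]
    congr 1
    apply h.epi_ext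
    rw [← Category.assoc, hw, Preadditive.sub_comp, Category.assoc, h.comp_eq_zero, comp_zero,
      sub_zero, Category.id_comp, Category.comp_id]

end IsSplitSeq

variable [HasFiniteBiproducts B]

attribute [local instance] hasBinaryBiproducts_of_finite_biproducts

variable {X Y X' Y' Z W : NComplex B N}

lemma isSplitSeq_cone (f : X ⟶ Y) : IsSplitSeq (coneInl f) (coneSnd f) := fun m =>
  ⟨coneFst f m, coneInr f m, coneInl_fst f m, coneInr_snd f m, cone_total f m⟩

lemma suspFamily_map_comp (hN : 2 ≤ N) (f : X ⟶ Y) (φ : (suspension B N).obj Y ⟶ W) :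
    suspFamily hN ((suspension B N).map f ≫ φ) = fun i => f.hom.app i ≫ suspFamily hN φ i := by
  funext i
  have := suspι_map f (i - N + 1) i (mem_top hN i)
  change suspι X (i - N + 1) i _ ≫ ((suspension B N).map f).hom.app _ ≫ φ.hom.app _ = _
  rw [reassoc_of% this, suspFamily]

lemma bd_suspFamily (hN : 2 ≤ N) (φ : (suspension B N).obj X ⟶ W) : bd (suspFamily hN φ) = 0 := by
  rw [← coneFamily_snd_comp hN (𝟙 X), ← bd_coneFamily, ← Category.assoc (coneInl _), coneInl_snd,
    zero_comp, comp_zero]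

lemma exists_suspFamily_eq (hN : 2 ≤ N) (t : HtpyFamily X W) (ht : bd t = 0) :
    ∃ φ : (suspension B N).obj X ⟶ W, suspFamily hN φ = t := by
  obtain ⟨φ, hφ⟩ := (isSplitSeq_cone (𝟙 X)).exists_desc
    (coneDesc (0 : X ⟶ W) t (by rw [ht, comp_zero])) (coneInl_desc _ _ _)
  refine ⟨φ, ?_⟩
  rw [← coneFamily_snd_comp hN (𝟙 X), hφ, coneFamily_desc]

lemma coneSnd_comp_suspension_map (hN : 2 ≤ N) (f : X ⟶ Y) (φ : (suspension B N).obj Y ⟶ W) :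
    coneSnd f ≫ (suspension B N).map f ≫ φ = bd (fstFamily f (suspFamily hN φ)) := by
  refine cone_hom_ext hN ?_ ?_
  · rw [coneInl_bd_fstFamily, bd_suspFamily, ← Category.assoc, coneInl_snd, zero_comp]
  · rw [coneFamily_snd_comp, suspFamily_map_comp, coneFamily_bd_fstFamily]

lemma quotient_exists_cone_desc (f : X ⟶ Y) (y : (Q).obj Y ⟶ (Q).obj W)
    (hy : (Q).map f ≫ y = 0) : ∃ w : (Q).obj (cone f) ⟶ (Q).obj W, (Q).map (coneInl f) ≫ w = y := by
  obtain ⟨y, rfl⟩ := (Q).map_surjective y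
  rw [← (Q).map_comp] at hy
  obtain ⟨s, hs⟩ := exists_bd_of_quotient_map_eq_zero hy
  refine ⟨(Q).map (coneDesc y s hs), ?_⟩
  rw [← (Q).map_comp, coneInl_desc]

lemma quotient_exists_susp_desc (hN : 2 ≤ N) (f : X ⟶ Y)
    (w : (Q).obj ((suspension B N).obj X) ⟶ (Q).obj W) (hw : (Q).map (coneSnd f) ≫ w = 0) :
    ∃ y : (Q).obj ((suspension B N).obj Y) ⟶ (Q).obj W,
      (Q).map ((suspension B N).map f) ≫ y = w := by
  obtain ⟨w, rfl⟩ := (Q).map_surjective w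
  rw [← (Q).map_comp] at hw
  obtain ⟨t, ht⟩ := exists_bd_of_quotient_map_eq_zero hw
  let tY : HtpyFamily Y W := fun i => (coneInl f).hom.app i ≫ t i
  let tX : HtpyFamily ((suspension B N).obj X) W := fun i => coneInr f i ≫ t i
  have h1 : bd t = bd (fstFamily f tY) + coneSnd f ≫ bd tX := by
    rw [comp_bd, ← bd_add]
    congr 1
    funext i
    simp only [fstFamily, tY, tX]
    rw [← Category.assoc, ← Category.assoc, ← Preadditive.add_comp, cone_total, Category.id_comp]
  have h2 : coneSnd f ≫ (w - bd tX) = bd (fstFamily f tY) := by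
    rw [Preadditive.comp_sub, ht, h1, add_sub_cancel_right]
  have h3 : bd tY = 0 := by
    rw [← coneInl_bd_fstFamily f, ← h2, ← Category.assoc, coneInl_snd, zero_comp]
  obtain ⟨y, hy⟩ := exists_suspFamily_eq hN tY h3
  refine ⟨(Q).map y, ?_⟩
  have h4 : (suspension B N).map f ≫ y = w - bd tX := by
    apply (isSplitSeq_cone f).epi_ext
    rw [coneSnd_comp_suspension_map hN, hy, h2]
  rw [← (Q).map_comp, h4, (Q).map_sub, quotient_map_bd, sub_zero]

/-- The morphism of mapping cones induced by a commutative square. -/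
noncomputable def coneMap {f : X ⟶ Y} {f' : X' ⟶ Y'} (α : X ⟶ X') (β : Y ⟶ Y')
    (h : f ≫ β = α ≫ f') : cone f ⟶ cone f' :=
  ObjectProperty.homMk
    { app := fun m => coneDescApp f (β.hom.app m ≫ (coneInl f').hom.app m)
        (((suspension B N).map α).hom.app m ≫ coneInr f' m)
      naturality := fun m n g => by
        have hβ : ∀ n, f.hom.app n ≫ β.hom.app n = α.hom.app n ≫ f'.hom.app n := fun n =>
          congr_arg (fun g => g.hom.app n) h
        refine cone_app_ext ?_ ?_
        · rw [← Category.assoc, ← (coneInl f).hom.naturality, Category.assoc, coneInl_descApp,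
            ← Category.assoc _ _ ((cone f').obj.map g), coneInl_descApp, β.hom.naturality_assoc, (coneInl f').hom.naturality,
            Category.assoc]
        · refine susp_hom_ext fun a ha => ?_
          rw [suspι_coneInr_map_comp, ← Category.assoc _ _ ((cone f').obj.map g)]
          simp only [coneInl_descApp, coneInr_descApp]
          have h1 := suspι_map α m a ha
          have h2 := suspι_coneInr_map_comp f' g a ha (𝟙 _)
          rw [Category.comp_id, Category.comp_id, Category.comp_id] at h2
          rw [((suspension B N).map α).hom.naturality_assoc, reassoc_of% h1, Category.assoc,
            reassoc_of% h1, h2, Preadditive.comp_add]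
          have h3 := tr_naturality α.hom a n
          simp only [coneEntry, ite_comp, comp_ite, zero_comp, comp_zero, Category.assoc,
            reassoc_of% hβ, reassoc_of% h3] }

lemma coneInl_coneMap {f : X ⟶ Y} {f' : X' ⟶ Y'} (α : X ⟶ X') (β : Y ⟶ Y')
    (h : f ≫ β = α ≫ f') : coneInl f ≫ coneMap α β h = β ≫ coneInl f' :=
  hom_ext fun _ => coneInl_descApp f _ _

lemma coneInl_coneMap_app {f : X ⟶ Y} {f' : X' ⟶ Y'} (α : X ⟶ X') (β : Y ⟶ Y')
    (h : f ≫ β = α ≫ f') (m : ℤ) : (coneInl f).hom.app m ≫ (coneMap α β h).hom.app m =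
      β.hom.app m ≫ (coneInl f').hom.app m :=
  coneInl_descApp f _ _

lemma coneInr_coneMap_app {f : X ⟶ Y} {f' : X' ⟶ Y'} (α : X ⟶ X') (β : Y ⟶ Y')
    (h : f ≫ β = α ≫ f') (m : ℤ) : coneInr f m ≫ (coneMap α β h).hom.app m =
      ((suspension B N).map α).hom.app m ≫ coneInr f' m :=
  coneInr_descApp f _ _

lemma coneMap_coneSnd {f : X ⟶ Y} {f' : X' ⟶ Y'} (α : X ⟶ X') (β : Y ⟶ Y')
    (h : f ≫ β = α ≫ f') : coneMap α β h ≫ coneSnd f' = coneSnd f ≫ (suspension B N).map α := by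
  refine hom_ext fun m => cone_app_ext ?_ ?_
  · change (coneInl f).hom.app m ≫ (coneMap α β h).hom.app m ≫ (coneSnd f').hom.app m =
      (coneInl f).hom.app m ≫ (coneSnd f).hom.app m ≫ ((suspension B N).map α).hom.app m
    rw [← Category.assoc, ← Category.assoc, coneInl_snd_app, zero_comp, coneInl_coneMap_app,
      Category.assoc, coneInl_snd_app, comp_zero]
  · change coneInr f m ≫ (coneMap α β h).hom.app m ≫ (coneSnd f').hom.app m =
      coneInr f m ≫ (coneSnd f).hom.app m ≫ ((suspension B N).map α).hom.app m
    rw [← Category.assoc, ← Category.assoc, coneInr_snd, Category.id_comp, coneInr_coneMap_app,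
      Category.assoc, coneInr_snd, Category.comp_id]

/-- The suspension of a morphism which is an isomorphism in the homotopy category. -/
lemma isIso_quotient_suspension_map (α : X ⟶ X') [IsIso ((Q).map α)] :
    IsIso ((Q).map ((suspension B N).map α)) :=
  inferInstanceAs (IsIso ((NHomotopyCategory.translation B N).map ((Q).map α)))

/-- The five lemma for mapping cones. -/
lemma isIso_quotient_coneMap (hN : 2 ≤ N) {f : X ⟶ Y} {f' : X' ⟶ Y'} (α : X ⟶ X') (β : Y ⟶ Y')
    (h : f ≫ β = α ≫ f') [IsIso ((Q).map α)] [IsIso ((Q).map β)] :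
    IsIso ((Q).map (coneMap α β h)) := by
  have := isIso_quotient_suspension_map (N := N) α
  have := isIso_quotient_suspension_map (N := N) β
  have hI : (Q).map (coneInl f) ≫ (Q).map (coneMap α β h) =
      (Q).map β ≫ (Q).map (coneInl f') := by
    rw [← (Q).map_comp, coneInl_coneMap, (Q).map_comp]
  have hS : (Q).map (coneMap α β h) ≫ (Q).map (coneSnd f') =
      (Q).map (coneSnd f) ≫ (Q).map ((suspension B N).map α) := by
    rw [← (Q).map_comp, coneMap_coneSnd, (Q).map_comp]
  have hf : (Q).map f ≫ (Q).map β = (Q).map α ≫ (Q).map f' := by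
    rw [← (Q).map_comp, h, (Q).map_comp]
  have hTf : (Q).map ((suspension B N).map f) ≫ (Q).map ((suspension B N).map β) =
      (Q).map ((suspension B N).map α) ≫ (Q).map ((suspension B N).map f') := by
    rw [← (Q).map_comp, ← (Q).map_comp, ← (suspension B N).map_comp, h,
      (suspension B N).map_comp]
  have hfi : ∀ {A C : NComplex B N} (g : A ⟶ C), (Q).map g ≫ (Q).map (coneInl g) = 0 := by
    intro A C g
    have := bd_coneFamily hN (𝟙 (cone g))
    rw [Category.comp_id] at this
    rw [← (Q).map_comp, this, quotient_map_bd]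
  have hST : (Q).map (coneSnd f') ≫ (Q).map ((suspension B N).map f') = 0 := by
    have := coneSnd_comp_suspension_map hN f' (𝟙 _)
    rw [Category.comp_id] at this
    rw [← (Q).map_comp, this, quotient_map_bd]
  have surj : ∀ {W : NComplex B N} (v : (Q).obj (cone f) ⟶ (Q).obj W),
      ∃ v', (Q).map (coneMap α β h) ≫ v' = v := by
    intro W v
    obtain ⟨v₁, hv₁⟩ := quotient_exists_cone_desc f' (inv ((Q).map β) ≫ (Q).map (coneInl f) ≫ v)
      (by
        rw [← cancel_epi ((Q).map α), ← reassoc_of% hf, IsIso.hom_inv_id_assoc,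
          reassoc_of% (hfi f), zero_comp, comp_zero])
    obtain ⟨w, hw⟩ := (isSplitSeq_cone f).exists_quotient_desc
      (v - (Q).map (coneMap α β h) ≫ v₁) (by
        rw [Preadditive.comp_sub, reassoc_of% hI, hv₁, IsIso.hom_inv_id_assoc, sub_self])
    refine ⟨v₁ + (Q).map (coneSnd f') ≫ inv ((Q).map ((suspension B N).map α)) ≫ w, ?_⟩
    rw [Preadditive.comp_add, reassoc_of% hS, IsIso.hom_inv_id_assoc, hw, add_sub_cancel]
  have inj : ∀ {W : NComplex B N} (v : (Q).obj (cone f') ⟶ (Q).obj W),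
      (Q).map (coneMap α β h) ≫ v = 0 → v = 0 := by
    intro W v hv
    obtain ⟨w, rfl⟩ := (isSplitSeq_cone f').exists_quotient_desc v (by
      rw [← cancel_epi ((Q).map β), ← reassoc_of% hI, hv, comp_zero, comp_zero])
    obtain ⟨y, hy⟩ := quotient_exists_susp_desc hN f ((Q).map ((suspension B N).map α) ≫ w)
      (by rw [← reassoc_of% hS, hv])
    have hw : w = (Q).map ((suspension B N).map f') ≫
        inv ((Q).map ((suspension B N).map β)) ≫ y := by
      rw [← cancel_epi ((Q).map ((suspension B N).map α)), ← reassoc_of% hTf,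
        IsIso.hom_inv_id_assoc, hy]
    rw [hw, reassoc_of% hST, zero_comp]
  obtain ⟨r, hr⟩ := surj (𝟙 _)
  refine ⟨r, hr, ?_⟩
  rw [← sub_eq_zero]
  apply inj
  rw [Preadditive.comp_sub, reassoc_of% hr, Category.comp_id, sub_self]

/-- The mapping cone of an identity morphism is contractible. -/
lemma nullHomotopic_id_cone_id (hN : 2 ≤ N) (X : NComplex B N) :
    NullHomotopic (𝟙 (cone (𝟙 X))) := by
  rw [nullHomotopic_iff]
  refine ⟨fstFamily (𝟙 X) (coneFamily hN (𝟙 (cone (𝟙 X)))), cone_hom_ext hN ?_ ?_⟩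
  · rw [coneInl_bd_fstFamily, ← bd_coneFamily, Category.id_comp]
  · rw [coneFamily_bd_fstFamily]
    funext i
    exact (Category.id_comp _).symm

/-- The morphism `C(i) ⟶ Z` attached to a morphism `p : Y ⟶ Z` such that `i ≫ p = 0`. -/
noncomputable def coneToQuot {i : X ⟶ Y} (p : Y ⟶ Z) (h : i ≫ p = 0) : cone i ⟶ Z :=
  coneDesc p (fun _ => 0) (by
    rw [h]
    refine hom_ext fun m => ?_
    simp only [bd_app, htpyTerm, zero_comp, comp_zero, Finset.sum_const_zero]
    rfl)

lemma coneInl_coneToQuot {i : X ⟶ Y} (p : Y ⟶ Z) (h : i ≫ p = 0) :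
    coneInl i ≫ coneToQuot p h = p :=
  coneInl_desc _ _ _

lemma coneInl_coneToQuot_app {i : X ⟶ Y} (p : Y ⟶ Z) (h : i ≫ p = 0) (m : ℤ) :
    (coneInl i).hom.app m ≫ (coneToQuot p h).hom.app m = p.hom.app m :=
  coneInl_descApp i _ _

lemma coneInr_coneToQuot_app {i : X ⟶ Y} (p : Y ⟶ Z) (h : i ≫ p = 0) (m : ℤ) :
    coneInr i m ≫ (coneToQuot p h).hom.app m = 0 := by
  refine (coneInr_descApp i _ _).trans (susp_hom_ext fun a ha => ?_)
  simp [descEntry, htpyTerm]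

lemma coneMap_coneToQuot {i : X ⟶ Y} {i' : X' ⟶ Y'} {p : Y ⟶ Z} {p' : Y' ⟶ W} (h : i ≫ p = 0)
    (h' : i' ≫ p' = 0) (α : X ⟶ X') (β : Y ⟶ Y') (γ : Z ⟶ W) (hαβ : i ≫ β = α ≫ i')
    (hβγ : p ≫ γ = β ≫ p') : coneMap α β hαβ ≫ coneToQuot p' h' = coneToQuot p h ≫ γ := by
  refine hom_ext fun m => ?_
  change (coneMap α β hαβ).hom.app m ≫ (coneToQuot p' h').hom.app m =
    (coneToQuot p h).hom.app m ≫ γ.hom.app m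
  refine cone_app_ext ?_ ?_
  · rw [← Category.assoc, ← Category.assoc, coneInl_coneMap_app, coneInl_coneToQuot_app,
      Category.assoc, coneInl_coneToQuot_app]
    exact (congr_arg (fun g => g.hom.app m) hβγ).symm
  · rw [← Category.assoc, ← Category.assoc, coneInr_coneMap_app, coneInr_coneToQuot_app,
      Category.assoc, coneInr_coneToQuot_app, comp_zero, zero_comp]

/-- The morphism from the mapping cone of the first morphism of a split sequence to its third
object is an isomorphism in the homotopy category: its kernel is the mapping cone of an
identity. -/
lemma IsSplitSeq.isIso_coneToQuot (hN : 2 ≤ N) {i : X ⟶ Y} {p : Y ⟶ Z} (h : IsSplitSeq i p) :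
    IsIso ((Q).map (coneToQuot p h.comp_eq_zero)) := by
  refine IsSplitSeq.isIso_quotient_map (i := coneMap (𝟙 X) i rfl) (fun m => ?_)
    (nullHomotopic_id_cone_id hN X)
  obtain ⟨r, t, h1, h2, h3⟩ := h m
  have hid : ((suspension B N).map (𝟙 X)).hom.app m = 𝟙 _ := by
    rw [(suspension B N).map_id]
    rfl
  refine ⟨coneDescApp i (r ≫ (coneInl (𝟙 X)).hom.app m) (coneInr (𝟙 X) m),
    t ≫ (coneInl i).hom.app m, cone_app_ext ?_ ?_, ?_, cone_app_ext ?_ ?_⟩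
  · rw [← Category.assoc, coneInl_coneMap_app, Category.assoc, coneInl_descApp,
      ← Category.assoc, h1, Category.id_comp, Category.comp_id]
  · rw [← Category.assoc, coneInr_coneMap_app, Category.assoc, coneInr_descApp, hid,
      Category.id_comp, Category.comp_id]
  · rw [Category.assoc, coneInl_coneToQuot_app, h2]
  · rw [Preadditive.comp_add, ← Category.assoc, ← Category.assoc, coneInl_descApp,
      coneInl_coneToQuot_app, Category.assoc, coneInl_coneMap_app, ← Category.assoc,
      ← Category.assoc, ← Preadditive.add_comp, h3, Category.id_comp, Category.comp_id]
  · rw [Preadditive.comp_add, ← Category.assoc, ← Category.assoc, coneInr_descApp,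
      coneInr_coneToQuot_app, coneInr_coneMap_app, hid, zero_comp, add_zero, Category.id_comp,
      Category.comp_id]

end Exactness

end NComplex

/-! ### Reindexing along periodic maps -/

namespace NComplex

section Reindexing

variable {B : Type u} [Category.{v} B] [Preadditive B] {N : ℕ}

local notation "Q" => NHomotopyCategory.quotient B N

/-- A functor `P : ℤ ⥤ ℤ`, that is a monotone map, is `N`-periodic if it commutes with translation
by `N`. -/
def IsPeriodic (N : ℕ) (P : ℤ ⥤ ℤ) : Prop := ∀ i : ℤ, P.obj (i + N) = P.obj i + N

/-- Reindexing of `N`-complexes along an `N`-periodic monotone map. -/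
noncomputable def pull (P : ℤ ⥤ ℤ) (hP : IsPeriodic N P) : NComplex B N ⥤ NComplex B N where
  obj X := ⟨P ⋙ X.obj, fun i => by
    change X.obj.map (P.map _) = 0
    rw [map_eq_tr]
    exact tr_eq_zero X.property (hP i).ge⟩
  map f := ObjectProperty.homMk (Functor.whiskerLeft P f.hom)

variable {P : ℤ ⥤ ℤ} {hP : IsPeriodic N P}

lemma tr_pull (X : NComplex B N) {i j : ℤ} (h : i ≤ j) :
    tr ((pull P hP).obj X).obj i j = tr X.obj (P.obj i) (P.obj j) := by
  rw [tr_of_le _ h, ← map_eq_tr X.obj (P.map (homOfLE h))]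
  rfl

lemma sum_Ico_functor {M : Type*} [AddCommMonoid M] (P : ℤ ⥤ ℤ) (g : ℤ → M) (m : ℤ) (k : ℕ) :
    ∑ j ∈ Finset.Ico m (m + k), ∑ i ∈ Finset.Ico (P.obj j) (P.obj (j + 1)), g i =
      ∑ i ∈ Finset.Ico (P.obj m) (P.obj (m + k)), g i := by
  have hle : ∀ i j : ℤ, i ≤ j → P.obj i ≤ P.obj j := fun i j h => leOfHom (P.map (homOfLE h))
  induction k with
  | zero => simp
  | succ k ih =>
    push_cast
    rw [sum_Ico_split _ (show m ≤ m + k by omega) (show m + (k : ℤ) ≤ m + (k + 1) by omega), ih,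
      sum_Ico_split g (hle m (m + k) (by omega)) (hle (m + k) (m + (k + 1)) (by omega)),
      ← add_assoc, ← Order.succ_eq_add_one (m + (k : ℤ)), Finset.Ico_succ_right_eq_Icc,
      Finset.Icc_self, Finset.sum_singleton, Order.succ_eq_add_one]

/-- Reindexing preserves null-homotopic morphisms: the homotopy in degree `j` collects the terms of
the given homotopy with index in `[P j, P (j + 1))`. -/
lemma NullHomotopic.pull {X Y : NComplex B N} {f : X ⟶ Y} (hf : NullHomotopic f) :
    NullHomotopic ((pull P hP).map f) := by
  have hle : ∀ i j : ℤ, i ≤ j → P.obj i ≤ P.obj j := fun i j h => leOfHom (P.map (homOfLE h))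
  obtain ⟨s, rfl⟩ := (nullHomotopic_iff _).1 hf
  rw [nullHomotopic_iff]
  refine ⟨fun j => ∑ i ∈ Finset.Ico (P.obj j) (P.obj (j + 1)),
    htpyTerm s (P.obj j) (P.obj (j - N + 1)) i, hom_ext fun m => ?_⟩
  change (bd s).hom.app (P.obj m) = _
  rw [bd_app, bd_app, ← hP m, ← sum_Ico_functor]
  refine Finset.sum_congr rfl fun j hj => ?_
  rw [Finset.mem_Ico] at hj
  have h1 : P.obj (j + 1) = P.obj (j - N + 1) + N := by
    rw [← hP]
    congr 1
    ring
  have key : tr X.obj (P.obj m) (P.obj j) ≫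
      (∑ i ∈ Finset.Ico (P.obj j) (P.obj (j + 1)),
        htpyTerm s (P.obj j) (P.obj (j - N + 1)) i) ≫ tr Y.obj (P.obj (j - N + 1)) (P.obj m) =
      ∑ i ∈ Finset.Ico (P.obj j) (P.obj (j + 1)), htpyTerm s (P.obj m) (P.obj m) i := by
    rw [sum_comp_tr s (hle _ _ (by omega)) h1.le, tr_comp_sum s (hle _ _ hj.1) le_rfl]
  rw [htpyTerm, tr_pull X hj.1, tr_pull Y (by omega)]
  exact key.symm

lemma IsSplitSeq.pull {X Y Z : NComplex B N} {i : X ⟶ Y} {p : Y ⟶ Z} (h : IsSplitSeq i p) :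
    IsSplitSeq ((pull P hP).map i) ((pull P hP).map p) := fun m => h (P.obj m)

instance : (pull (B := B) P hP).Additive where
  map_add := rfl

variable (P hP) in
/-- Reindexing on the homotopy category. -/
noncomputable def pullK : NHomotopyCategory B N ⥤ NHomotopyCategory B N :=
  CategoryTheory.Quotient.lift _ (pull P hP ⋙ Q) fun _ _ f g h => by
    refine CategoryTheory.Quotient.sound _ ?_
    change NullHomotopic ((pull P hP).map f - (pull P hP).map g)
    rw [← (pull P hP).map_sub]
    exact NullHomotopic.pull h

lemma isIso_quotient_pull_map {X Y : NComplex B N} (f : X ⟶ Y) [IsIso ((Q).map f)] :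
    IsIso ((Q).map ((pull P hP).map f)) :=
  inferInstanceAs (IsIso ((pullK P hP).map ((Q).map f)))

/-- Monotone maps with the same values induce isomorphic diagrams. -/
noncomputable def functorIsoOfObjEq {P P' : ℤ ⥤ ℤ} (h : ∀ m, P.obj m = P'.obj m) : P ≅ P' :=
  NatIso.ofComponents (fun m => eqToIso (h m)) (fun _ => Subsingleton.elim _ _)

/-- The natural transformation from a reindexing along a map which is bounded above by the
identity. -/
noncomputable def pullε (hP : IsPeriodic N P) (η : P ⟶ 𝟭 ℤ) : pull (B := B) P hP ⟶ 𝟭 _ where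
  app X := ObjectProperty.homMk (Functor.whiskerRight η X.obj)
  naturality X Y f := by
    refine hom_ext fun m => ?_
    exact (f.hom.naturality (η.app m)).symm

/-- An `N`-complex is collapsed along `P` if `pullε` is an isomorphism in the homotopy
category. -/
def IsCollapsed (hP : IsPeriodic N P) (η : P ⟶ 𝟭 ℤ) (X : NComplex B N) : Prop :=
  IsIso ((Q).map ((pullε hP η).app X))

variable {η : P ⟶ 𝟭 ℤ}

lemma isCollapsed_of_iso {X Y : NComplex B N} (e : (Q).obj X ≅ (Q).obj Y)
    (hX : IsCollapsed hP η X) : IsCollapsed hP η Y := by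
  have : IsIso ((Q).map ((pullε hP η).app X)) := hX
  obtain ⟨f, hf⟩ := (Q).map_surjective e.hom
  have hf' : IsIso ((Q).map f) := by rw [hf]; infer_instance
  have h1 := isIso_quotient_pull_map (P := P) (hP := hP) f
  have h2 : (Q).map ((pull P hP).map f) ≫ (Q).map ((pullε hP η).app Y) =
      (Q).map ((pullε hP η).app X) ≫ (Q).map f := by
    rw [← (Q).map_comp, (pullε hP η).naturality, (Q).map_comp]
    rfl
  have h3 : IsIso ((Q).map ((pull P hP).map f) ≫ (Q).map ((pullε hP η).app Y)) := by
    rw [h2]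
    infer_instance
  exact IsIso.of_isIso_comp_left ((Q).map ((pull P hP).map f)) _

lemma isIso_quotient_of_contractible {X Y : NComplex B N} (f : X ⟶ Y)
    (hX : NullHomotopic (𝟙 X)) (hY : NullHomotopic (𝟙 Y)) : IsIso ((Q).map f) := by
  rw [← quotient_map_eq_zero_iff] at hX hY
  refine ⟨0, ?_, ?_⟩
  · rw [comp_zero, ← (Q).map_id, hX]
  · rw [zero_comp, ← (Q).map_id, hY]

lemma isCollapsed_of_contractible {X : NComplex B N} (hX : NullHomotopic (𝟙 X)) :
    IsCollapsed hP η X := by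
  refine isIso_quotient_of_contractible _ ?_ hX
  rw [← (pull P hP).map_id]
  exact hX.pull

variable [HasFiniteBiproducts B]

attribute [local instance] hasBinaryBiproducts_of_finite_biproducts

/-- The third object of a split sequence is collapsed if the first two are. -/
lemma IsSplitSeq.isCollapsed₃ (hN : 2 ≤ N) {X Y Z : NComplex B N} {i : X ⟶ Y} {p : Y ⟶ Z}
    (h : IsSplitSeq i p) (hX : IsCollapsed hP η X) (hY : IsCollapsed hP η Y) :
    IsCollapsed hP η Z := by
  have : IsIso ((Q).map ((pullε hP η).app X)) := hX
  have : IsIso ((Q).map ((pullε hP η).app Y)) := hY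
  have hi := (pullε hP η).naturality i
  have hp := (pullε hP η).naturality p
  have h1 := isIso_quotient_coneMap hN ((pullε hP η).app X) ((pullε hP η).app Y) hi
  have h2 := h.isIso_coneToQuot hN
  have h3 := (h.pull (P := P) (hP := hP)).isIso_coneToQuot hN
  have h4 := coneMap_coneToQuot (h.pull (P := P) (hP := hP)).comp_eq_zero h.comp_eq_zero
    ((pullε hP η).app X) ((pullε hP η).app Y) ((pullε hP η).app Z) hi hp
  have h5 : IsIso ((Q).map (coneToQuot _ (h.pull (P := P) (hP := hP)).comp_eq_zero) ≫
      (Q).map ((pullε hP η).app Z)) := by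
    rw [← (Q).map_comp, ← h4, (Q).map_comp]
    infer_instance
  exact IsIso.of_isIso_comp_left
    ((Q).map (coneToQuot _ (h.pull (P := P) (hP := hP)).comp_eq_zero)) _

/-- The direct sum of two `N`-complexes. -/
noncomputable def dirSum (X Y : NComplex B N) : NComplex B N :=
  ⟨{ obj := fun m => X.obj.obj m ⊞ Y.obj.obj m
     map := fun g => biprod.map (X.obj.map g) (Y.obj.map g) }, fun m => by
    change biprod.map _ _ = 0
    rw [X.property m, Y.property m]
    ext <;> simp⟩

/-- The morphism to a direct sum with given components. -/
noncomputable def dirSumLift {W X Y : NComplex B N} (f : W ⟶ X) (g : W ⟶ Y) : W ⟶ dirSum X Y :=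
  ObjectProperty.homMk
    { app := fun m => biprod.lift (f.hom.app m) (g.hom.app m)
      naturality := fun m n φ => by
        change W.obj.map φ ≫ biprod.lift (f.hom.app n) (g.hom.app n) =
          biprod.lift (f.hom.app m) (g.hom.app m) ≫ biprod.map (X.obj.map φ) (Y.obj.map φ)
        ext <;> simp }

/-- The morphism from a direct sum with given components. -/
noncomputable def dirSumDesc {W X Y : NComplex B N} (f : X ⟶ W) (g : Y ⟶ W) : dirSum X Y ⟶ W :=
  ObjectProperty.homMk
    { app := fun m => biprod.desc (f.hom.app m) (g.hom.app m)
      naturality := fun m n φ => by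
        change biprod.map (X.obj.map φ) (Y.obj.map φ) ≫ biprod.desc (f.hom.app n) (g.hom.app n) =
          biprod.desc (f.hom.app m) (g.hom.app m) ≫ W.obj.map φ
        ext <;> simp }

/-- A criterion for a sequence `W ⟶ X ⊞ Y ⟶ Z` to be split, in terms of the entries of the
matrices. -/
lemma isSplitSeq_dirSum {W X Y Z : NComplex B N} (f : W ⟶ X) (g : W ⟶ Y) (k : X ⟶ Z) (l : Y ⟶ Z)
    (h : ∀ m : ℤ, ∃ (r₁ : X.obj.obj m ⟶ W.obj.obj m) (r₂ : Y.obj.obj m ⟶ W.obj.obj m)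
      (t₁ : Z.obj.obj m ⟶ X.obj.obj m) (t₂ : Z.obj.obj m ⟶ Y.obj.obj m),
      f.hom.app m ≫ r₁ + g.hom.app m ≫ r₂ = 𝟙 _ ∧ t₁ ≫ k.hom.app m + t₂ ≫ l.hom.app m = 𝟙 _ ∧
      r₁ ≫ f.hom.app m + k.hom.app m ≫ t₁ = 𝟙 _ ∧ r₁ ≫ g.hom.app m + k.hom.app m ≫ t₂ = 0 ∧
      r₂ ≫ f.hom.app m + l.hom.app m ≫ t₁ = 0 ∧ r₂ ≫ g.hom.app m + l.hom.app m ≫ t₂ = 𝟙 _) :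
    IsSplitSeq (dirSumLift f g) (dirSumDesc k l) := fun m => by
  obtain ⟨r₁, r₂, t₁, t₂, h1, h2, h3, h4, h5, h6⟩ := h m
  have key : biprod.desc r₁ r₂ ≫ biprod.lift (f.hom.app m) (g.hom.app m) +
      biprod.desc (k.hom.app m) (l.hom.app m) ≫ biprod.lift t₁ t₂ = 𝟙 _ := by
    ext
    · simp [h3]
    · simp [h4]
    · simp [h5]
    · simp [h6]
  exact ⟨biprod.desc r₁ r₂, biprod.lift t₁ t₂, (biprod.lift_desc ..).trans h1,
    (biprod.lift_desc ..).trans h2, key⟩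

/-- The mapping cone as the cokernel of a split monomorphism from `X` to the sum of `Y` and of a
contractible complex. -/
lemma isSplitSeq_cone_presentation {X Y : NComplex B N} (f : X ⟶ Y) :
    IsSplitSeq (dirSumLift (-f) (coneInl (𝟙 X)))
      (dirSumDesc (coneInl f) (coneMap (𝟙 X) f (by rw [Category.id_comp]) :
        cone (𝟙 X) ⟶ cone f)) := isSplitSeq_dirSum _ _ _ _ fun m => by
  have hid : ((suspension B N).map (𝟙 X)).hom.app m = 𝟙 _ := by
    rw [(suspension B N).map_id]
    rfl
  have h0 := coneInl_coneMap_app (𝟙 X) f (show 𝟙 X ≫ f = 𝟙 X ≫ f from rfl) m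
  have h1 := (coneInr_coneMap_app (𝟙 X) f (show 𝟙 X ≫ f = 𝟙 X ≫ f from rfl) m).trans
    ((congr_arg (fun x => x ≫ coneInr f m) hid).trans (Category.id_comp _))
  have hneg : (-f).hom.app m = -f.hom.app m := rfl
  refine ⟨0, coneFst (𝟙 X) m, coneFst f m, (coneSnd f).hom.app m ≫ coneInr (𝟙 X) m,
    ?_, ?_, ?_, ?_, ?_, ?_⟩
  · rw [comp_zero, zero_add, coneInl_fst]
  · rw [Category.assoc, h1, cone_total]
  · rw [zero_comp, zero_add, coneInl_fst]
  · rw [zero_comp, zero_add, ← Category.assoc, coneInl_snd_app, zero_comp]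
  · refine cone_app_ext ?_ ?_
    · rw [Preadditive.comp_add, reassoc_of% h0, ← Category.assoc, coneInl_fst, coneInl_fst,
        hneg, Category.id_comp, Category.comp_id, neg_add_cancel, comp_zero]
    · rw [Preadditive.comp_add, reassoc_of% h1, ← Category.assoc, coneInr_fst, coneInr_fst,
        zero_comp, zero_add, comp_zero]
  · refine cone_app_ext ?_ ?_
    · rw [Preadditive.comp_add, reassoc_of% h0, ← Category.assoc, coneInl_fst,
        ← Category.assoc _ _ (coneInr _ _), coneInl_snd_app, zero_comp, comp_zero, add_zero,
        Category.id_comp, Category.comp_id]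
    · rw [Preadditive.comp_add, reassoc_of% h1, ← Category.assoc, coneInr_fst,
        ← Category.assoc _ _ (coneInr _ _), coneInr_snd, zero_comp, zero_add, Category.id_comp,
        Category.comp_id]

/-- A mapping cone is collapsed if the source and the target are. -/
lemma isCollapsed_cone (hN : 2 ≤ N) {X Y : NComplex B N} (f : X ⟶ Y) (hX : IsCollapsed hP η X)
    (hY : IsCollapsed hP η Y) : IsCollapsed hP η (cone f) := by
  refine (isSplitSeq_cone_presentation f).isCollapsed₃ hN hX ?_
  have h : IsSplitSeq (dirSumLift 0 (𝟙 _)) (dirSumDesc (𝟙 Y) (0 : cone (𝟙 X) ⟶ Y)) :=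
    isSplitSeq_dirSum _ _ _ _ fun m => ⟨0, 𝟙 _, 𝟙 _, 0, by simp⟩
  have := h.isIso_quotient_map (nullHomotopic_id_cone_id hN X)
  exact isCollapsed_of_iso (asIso ((Q).map (dirSumDesc (𝟙 Y) (0 : cone (𝟙 X) ⟶ Y)))).symm hY

end Reindexing

end NComplex

/-! ### The double suspension -/

namespace NComplex

section DoubleSuspension

variable {B : Type u} [Category.{v} B] [Preadditive B] {N : ℕ}

local notation "Q" => NHomotopyCategory.quotient B N

/-- Translation of `ℤ` by `c`. -/
noncomputable def translate (c : ℤ) : ℤ ⥤ ℤ :=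
  Monotone.functor (f := fun i => i + c) fun _ _ h => by dsimp only; omega

lemma isPeriodic_translate (c : ℤ) : IsPeriodic N (translate c) := fun i => by
  change i + N + c = i + c + N
  ring

/-- The shift `X[c]` of an `N`-complex `X`. -/
noncomputable abbrev shiftBy (c : ℤ) : NComplex B N ⥤ NComplex B N :=
  pull (translate c) (isPeriodic_translate c)

variable {P : ℤ ⥤ ℤ} {hP : IsPeriodic N P} {η : P ⟶ 𝟭 ℤ}

lemma IsCollapsed.shiftBy {X : NComplex B N} (hX : IsCollapsed hP η X) (c : ℤ)
    (hc : ∀ i, P.obj (i + c) = P.obj i + c) : IsCollapsed hP η ((shiftBy c).obj X) := by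
  have : IsIso ((Q).map ((pullε hP η).app X)) := hX
  let e : (pull P hP).obj ((NComplex.shiftBy c).obj X) ≅
      (NComplex.shiftBy c).obj ((pull P hP).obj X) :=
    ObjectProperty.isoMk _ (Functor.isoWhiskerRight
      (functorIsoOfObjEq (P := P ⋙ translate c) (P' := translate c ⋙ P) fun m => (hc m).symm)
      X.obj)
  have h1 : (pullε hP η).app ((NComplex.shiftBy c).obj X) =
      e.hom ≫ (NComplex.shiftBy c).map ((pullε hP η).app X) := by
    refine hom_ext fun m => ?_
    change X.obj.map _ = X.obj.map _ ≫ X.obj.map _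
    rw [← X.obj.map_comp]
    rfl
  have h2 := isIso_quotient_pull_map (P := translate c) (hP := isPeriodic_translate c)
    ((pullε hP η).app X)
  change IsIso ((Q).map _)
  rw [h1, (Q).map_comp]
  exact IsIso.comp_isIso' inferInstance h2

/-- `X[c][d] = X` if `c + d = 0`. -/
noncomputable def shiftByShiftByIso (X : NComplex B N) {c d : ℤ} (h : c + d = 0) :
    (shiftBy c).obj ((shiftBy d).obj X) ≅ X :=
  ObjectProperty.isoMk _ (Functor.isoWhiskerRight
    (functorIsoOfObjEq (P := translate c ⋙ translate d) (P' := 𝟭 ℤ) fun m => by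
      change m + c + d = m
      omega) X.obj)

lemma IsPeriodic.obj_add_neg (hP : IsPeriodic N P) (i : ℤ) :
    P.obj (i + -N) = P.obj i + -N := by
  have := hP (i + -N)
  rw [neg_add_cancel_right] at this
  omega

lemma isCollapsed_shiftBy_iff {X : NComplex B N} :
    IsCollapsed hP η ((shiftBy (N : ℤ)).obj X) ↔ IsCollapsed hP η X := by
  refine ⟨fun h => ?_, fun h => h.shiftBy _ hP⟩
  exact isCollapsed_of_iso ((Q).mapIso (shiftByShiftByIso X (by ring)))
    (h.shiftBy (-N) hP.obj_add_neg)

/-- The entry `Xᵃ ⟶ Xᵇ` of an identity matrix. -/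
noncomputable def idEntry (X : ℤ ⥤ B) (a b : ℤ) : X.obj a ⟶ X.obj b :=
  if a = b then tr X a b else 0

lemma sum_idEntry (X : ℤ ⥤ B) (S : Finset ℤ) (a : ℤ) {Z : B} (h : ∀ b, X.obj b ⟶ Z) :
    ∑ b : S, idEntry X a b ≫ h b = if a ∈ S then h a else 0 := by
  rw [Finset.sum_coe_sort S (fun b => idEntry X a b ≫ h b)]
  simp only [idEntry, ite_comp, zero_comp]
  rw [Finset.sum_ite_eq, tr_self, Category.id_comp]

lemma sum_comp_idEntry (X : ℤ ⥤ B) (S : Finset ℤ) (c : ℤ) {Z : B} (h : ∀ b, Z ⟶ X.obj b) :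
    ∑ b : S, h b ≫ idEntry X b c = if c ∈ S then h c else 0 := by
  rw [Finset.sum_coe_sort S (fun b => h b ≫ idEntry X b c)]
  simp only [idEntry, comp_ite, comp_zero]
  rw [Finset.sum_ite_eq', tr_self, Category.comp_id]

variable [HasFiniteBiproducts B]

attribute [local instance] hasBinaryBiproducts_of_finite_biproducts

lemma matrix_idEntry (X : ℤ ⥤ B) (S : Finset ℤ) :
    biproduct.matrix (fun (a b : S) => idEntry X a b) = 𝟙 (⨁ fun a : S => X.obj a) := by
  apply biproduct.hom_ext'
  intro a
  apply biproduct.hom_ext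
  intro b
  rw [Category.assoc, biproduct.matrix_π, biproduct.ι_desc, Category.comp_id, idEntry]
  by_cases h : a = b
  · subst h
    simp
  · rw [if_neg (fun h' => h (Subtype.ext h')), biproduct.ι_π_ne _ h]

/-- The direct sum over all `i` of the complexes `Xⁱ = ⋯ = Xⁱ`, concentrated in the degrees
`i - N, …, i - 1`. -/
noncomputable def disc (X : NComplex B N) : NComplex B N :=
  ⟨{ obj := fun m => ⨁ fun i : Finset.Ioc m (m + (N : ℤ)) => X.obj.obj i
     map := fun {m n} _ => biproduct.matrix fun a b => idEntry X.obj a b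
     map_id := fun m => matrix_idEntry X.obj _
     map_comp := fun {m n p} f g => by
      rw [matrix_comp_matrix]
      congr 1
      funext a c
      rw [sum_idEntry X.obj _ _ (fun b => idEntry X.obj b c)]
      have ha := Finset.mem_Ioc.1 a.2
      have hc := Finset.mem_Ioc.1 c.2
      have h1 := leOfHom f
      have h2 := leOfHom g
      by_cases h : (a : ℤ) ∈ Finset.Ioc n (n + (N : ℤ))
      · rw [if_pos h]
      · rw [Finset.mem_Ioc] at h
        rw [if_neg (by rwa [Finset.mem_Ioc]), idEntry, if_neg (by omega)] }, fun m => by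
    change biproduct.matrix (fun (a : Finset.Ioc m (m + N))
      (b : Finset.Ioc (m + (N : ℤ)) (m + N + N)) => idEntry X.obj a b) = 0
    ext a b
    have ha := Finset.mem_Ioc.1 a.2
    have hb := Finset.mem_Ioc.1 b.2
    simp only [biproduct.matrix_π, biproduct.ι_desc, comp_zero, zero_comp]
    rw [idEntry, if_neg (by omega)]⟩

/-- The homotopy is the identity of the summand `Xʲ⁺¹` in degree `j`; each summand of `disc X` is
reached by exactly one term of the homotopy formula. -/
lemma nullHomotopic_id_disc (X : NComplex B N) : NullHomotopic (𝟙 (disc X)) := by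
  refine ⟨fun j => biproduct.matrix (fun (a : Finset.Ioc j (j + (N : ℤ)))
    (b : Finset.Ioc (j - (N : ℤ) + 1) (j - N + 1 + N)) =>
      if (a : ℤ) = j + 1 then idEntry X.obj a b else 0), fun m => ?_⟩
  change 𝟙 (⨁ fun i : Finset.Ioc m (m + (N : ℤ)) => X.obj.obj i) =
    ∑ j : Fin N, biproduct.matrix (fun (a : Finset.Ioc m (m + (N : ℤ)))
        (b : Finset.Ioc (m + (j : ℕ)) (m + (j : ℕ) + (N : ℤ))) => idEntry X.obj a b) ≫
      biproduct.matrix (fun (b : Finset.Ioc (m + (j : ℕ)) (m + (j : ℕ) + (N : ℤ)))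
        (c : Finset.Ioc (m + (j : ℕ) - (N : ℤ) + 1) (m + (j : ℕ) - N + 1 + N)) =>
          if (b : ℤ) = m + (j : ℕ) + 1 then idEntry X.obj b c else 0) ≫
      biproduct.matrix (fun (c : Finset.Ioc (m + (j : ℕ) - (N : ℤ) + 1) (m + (j : ℕ) - N + 1 + N))
        (l : Finset.Ioc m (m + (N : ℤ))) => idEntry X.obj c l)
  simp only [matrix_comp_matrix]
  rw [← matrix_idEntry X.obj]
  apply biproduct.hom_ext'
  intro a
  apply biproduct.hom_ext
  intro l
  rw [Preadditive.comp_sum, Preadditive.sum_comp]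
  simp only [Category.assoc]
  simp only [biproduct.matrix_π, biproduct.ι_desc]
  have ha := Finset.mem_Ioc.1 a.2
  have hl := Finset.mem_Ioc.1 l.2
  have hterm : ∀ q : ℤ, m ≤ q → q < m + N →
      ∑ b : Finset.Ioc q (q + (N : ℤ)), idEntry X.obj a b ≫
        ∑ c : Finset.Ioc (q - (N : ℤ) + 1) (q - N + 1 + N),
          (if (b : ℤ) = q + 1 then idEntry X.obj b c else 0) ≫ idEntry X.obj c l =
      if q = a - 1 then idEntry X.obj a l else 0 := by
    intro q h1 h2
    rw [sum_idEntry X.obj _ _ (fun b => ∑ c : Finset.Ioc (q - (N : ℤ) + 1) (q - N + 1 + N),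
          (if (b : ℤ) = q + 1 then idEntry X.obj b c else 0) ≫ idEntry X.obj c l)]
    by_cases h : (a : ℤ) = q + 1
    · simp only [if_pos h]
      rw [sum_idEntry X.obj _ _ (fun c => idEntry X.obj c l), if_pos, if_pos,
        if_pos (by omega)] <;> rw [Finset.mem_Ioc] <;> omega
    · simp only [if_neg h, zero_comp, Finset.sum_const_zero, ite_self]
      rw [if_neg (by omega)]
  rw [Finset.sum_congr rfl (fun (j : Fin N) _ => hterm (m + (j : ℕ)) (by omega) (by omega)),
    sum_fin_eq_sum_Ico N m (fun q => if q = (a : ℤ) - 1 then idEntry X.obj a l else 0),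
    Finset.sum_ite_eq', if_pos (by rw [Finset.mem_Ico]; omega)]

/-- The inclusion of `ΣX` into `disc X`, which is the matrix of the differential of `ΣX`. -/
noncomputable def discι (hN : 2 ≤ N) (X : NComplex B N) : (suspension B N).obj X ⟶ disc X :=
  ObjectProperty.homMk
    { app := fun m => biproduct.matrix (fun (a : Finset.Ioo m (m + (N : ℤ)))
        (b : Finset.Ioc m (m + (N : ℤ))) => suspEntry N X.obj m a b)
      naturality := fun m n g => by
        have hmn := leOfHom g
        change biproduct.matrix (fun (a : Finset.Ioo m (m + (N : ℤ)))
            (b : Finset.Ioo n (n + (N : ℤ))) => suspEntry N X.obj m a b) ≫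
          biproduct.matrix (fun (a : Finset.Ioo n (n + (N : ℤ)))
            (b : Finset.Ioc n (n + (N : ℤ))) => suspEntry N X.obj n a b) =
          biproduct.matrix (fun (a : Finset.Ioo m (m + (N : ℤ)))
            (b : Finset.Ioc m (m + (N : ℤ))) => suspEntry N X.obj m a b) ≫
          biproduct.matrix (fun (a : Finset.Ioc m (m + (N : ℤ)))
            (b : Finset.Ioc n (n + (N : ℤ))) => idEntry X.obj a b)
        rw [matrix_comp_matrix, matrix_comp_matrix]
        congr 1
        funext a c
        have ha := Finset.mem_Ioo.1 a.2
        have hc := Finset.mem_Ioc.1 c.2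
        rw [sum_comp_idEntry X.obj _ _ (fun b => suspEntry N X.obj m a b)]
        have h1 : ∑ b : Finset.Ioo n (n + (N : ℤ)), suspEntry N X.obj m a b ≫
            suspEntry N X.obj n b c = suspEntry N X.obj m a c := by
          by_cases h : (c : ℤ) = n + N
          · exact suspEntry_comp (p := n + 1) X.property hmn (by omega) a.2
              (by rw [Finset.mem_Ioo]; omega)
          · exact suspEntry_comp (p := n) X.property hmn le_rfl a.2
              (by rw [Finset.mem_Ioo]; omega)
        rw [h1]
        by_cases h : (c : ℤ) ∈ Finset.Ioc m (m + (N : ℤ))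
        · rw [if_pos h]
        · rw [if_neg h]
          rw [Finset.mem_Ioc] at h
          exact suspEntry_eq_zero X.obj ha.2 (by omega) }

/-- The projection from `disc X` to `X[N]`. -/
noncomputable def discπ (X : NComplex B N) : disc X ⟶ (shiftBy (N : ℤ)).obj X :=
  ObjectProperty.homMk
    { app := fun m => biproduct.desc
        (fun a : Finset.Ioc m (m + (N : ℤ)) => tr X.obj a (m + N))
      naturality := fun m n g => by
        have hmn := leOfHom g
        have key : biproduct.matrix (fun (a : Finset.Ioc m (m + (N : ℤ)))
            (b : Finset.Ioc n (n + (N : ℤ))) => idEntry X.obj a b) ≫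
            biproduct.desc (fun a : Finset.Ioc n (n + (N : ℤ)) => tr X.obj a (n + N)) =
            biproduct.desc (fun a : Finset.Ioc m (m + (N : ℤ)) => tr X.obj a (m + N)) ≫
              tr X.obj (m + N) (n + N) := by
          apply biproduct.hom_ext'
          intro a
          have ha := Finset.mem_Ioc.1 a.2
          rw [biproduct.ι_matrix_assoc, biproduct.lift_desc, biproduct.ι_desc_assoc,
            sum_idEntry X.obj _ _ (fun b => tr X.obj b (n + N)),
            tr_comp X.obj (by omega) (by omega)]
          by_cases h : (a : ℤ) ∈ Finset.Ioc n (n + (N : ℤ))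
          · rw [if_pos h]
          · rw [if_neg h]
            rw [Finset.mem_Ioc] at h
            exact (tr_eq_zero X.property (by omega)).symm
        rw [tr_of_le X.obj (show m + (N : ℤ) ≤ n + N by omega)] at key
        exact key }

lemma isSplitSeq_disc (hN : 2 ≤ N) (X : NComplex B N) :
    IsSplitSeq (discι hN X) (discπ X) := fun m => by
  have hm : m + (N : ℤ) ∈ Finset.Ioc m (m + (N : ℤ)) := by rw [Finset.mem_Ioc]; omega
  have key1 : biproduct.matrix (fun (a : Finset.Ioo m (m + (N : ℤ)))
      (b : Finset.Ioc m (m + (N : ℤ))) => suspEntry N X.obj m a b) ≫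
      biproduct.matrix (fun (a : Finset.Ioc m (m + (N : ℤ)))
        (b : Finset.Ioo m (m + (N : ℤ))) => idEntry X.obj a b) = 𝟙 _ := by
    rw [matrix_comp_matrix, ← matrix_idEntry X.obj]
    congr 1
    funext a c
    have hc := Finset.mem_Ioo.1 c.2
    rw [sum_comp_idEntry X.obj _ _ (fun b => suspEntry N X.obj m a b),
      if_pos (by rw [Finset.mem_Ioc]; omega), suspEntry_self X.obj c.2, idEntry]
  have key2 : biproduct.ι (fun a : Finset.Ioc m (m + (N : ℤ)) => X.obj.obj a) ⟨m + N, hm⟩ ≫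
      biproduct.desc (fun a : Finset.Ioc m (m + (N : ℤ)) => tr X.obj a (m + N)) = 𝟙 _ := by
    rw [biproduct.ι_desc, tr_self]
  have key3 : biproduct.matrix (fun (a : Finset.Ioc m (m + (N : ℤ)))
        (b : Finset.Ioo m (m + (N : ℤ))) => idEntry X.obj a b) ≫
      biproduct.matrix (fun (a : Finset.Ioo m (m + (N : ℤ)))
        (b : Finset.Ioc m (m + (N : ℤ))) => suspEntry N X.obj m a b) +
      biproduct.desc (fun a : Finset.Ioc m (m + (N : ℤ)) => tr X.obj a (m + N)) ≫
        biproduct.ι (fun a : Finset.Ioc m (m + (N : ℤ)) => X.obj.obj a) ⟨m + N, hm⟩ = 𝟙 _ := by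
    rw [matrix_comp_matrix, ← matrix_idEntry X.obj]
    apply biproduct.hom_ext'
    intro a
    apply biproduct.hom_ext
    intro c
    have ha := Finset.mem_Ioc.1 a.2
    have hc := Finset.mem_Ioc.1 c.2
    rw [Preadditive.comp_add, Preadditive.add_comp]
    simp only [Category.assoc]
    rw [biproduct.ι_desc_assoc, biproduct.matrix_π, biproduct.ι_desc, biproduct.matrix_π,
      biproduct.ι_desc, sum_idEntry X.obj _ _ (fun b => suspEntry N X.obj m b c)]
    by_cases h : (c : ℤ) = m + N
    · obtain ⟨c, hc'⟩ := c
      obtain rfl : c = m + N := h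
      rw [biproduct.ι_π_self, Category.comp_id]
      by_cases h' : (a : ℤ) = m + N
      · rw [if_neg (by rw [Finset.mem_Ioo]; omega), zero_add, idEntry, if_pos h']
      · rw [if_pos (by rw [Finset.mem_Ioo]; omega), suspEntry, if_pos rfl, sub_add_cancel,
          idEntry]
    · rw [biproduct.ι_π_ne _ (fun h' => h (congr_arg Subtype.val h').symm), comp_zero, add_zero]
      by_cases h' : (a : ℤ) = m + N
      · rw [if_neg (by rw [Finset.mem_Ioo]; omega), idEntry, if_neg (by omega)]
      · rw [if_pos (by rw [Finset.mem_Ioo]; omega), suspEntry, if_neg h, sub_zero, idEntry]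
  exact ⟨_, _, key1, key2, key3⟩

/-- The double suspension is isomorphic to the shift by `N` in the homotopy category. -/
lemma nonempty_iso_suspension_suspension (hN : 2 ≤ N) (X : NComplex B N) :
    Nonempty ((Q).obj ((suspension B N).obj ((suspension B N).obj X)) ≅
      (Q).obj ((shiftBy (N : ℤ)).obj X)) := by
  have h1 := (isSplitSeq_disc hN X).isIso_coneToQuot hN
  have h2 := (isSplitSeq_cone (discι hN X)).isIso_quotient_map (nullHomotopic_id_disc X)
  exact ⟨(asIso ((Q).map (coneSnd (discι hN X)))).symm ≪≫
    asIso ((Q).map (coneToQuot _ (isSplitSeq_disc hN X).comp_eq_zero))⟩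

lemma IsCollapsed.suspension (hN : 2 ≤ N) {X : NComplex B N} (hX : IsCollapsed hP η X) :
    IsCollapsed hP η ((suspension B N).obj X) :=
  (isSplitSeq_cone (𝟙 X)).isCollapsed₃ hN hX
    (isCollapsed_of_contractible (nullHomotopic_id_cone_id hN X))

lemma isCollapsed_of_suspension (hN : 2 ≤ N) {X : NComplex B N}
    (hX : IsCollapsed hP η ((suspension B N).obj X)) : IsCollapsed hP η X := by
  obtain ⟨e⟩ := nonempty_iso_suspension_suspension hN X
  exact isCollapsed_shiftBy_iff.1 (isCollapsed_of_iso e (hX.suspension hN))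

/-- Every collapsed complex is the suspension of a collapsed complex, in the homotopy
category. -/
lemma IsCollapsed.exists_suspension_iso (hN : 2 ≤ N) {X : NComplex B N}
    (hX : IsCollapsed hP η X) : ∃ Y : NComplex B N, IsCollapsed hP η Y ∧
      Nonempty ((Q).obj ((NComplex.suspension B N).obj Y) ≅ (Q).obj X) := by
  let X' := (NComplex.shiftBy (-N)).obj X
  obtain ⟨e⟩ := nonempty_iso_suspension_suspension hN X'
  exact ⟨(NComplex.suspension B N).obj X', (hX.shiftBy _ hP.obj_add_neg).suspension hN,
    ⟨e ≪≫ (Q).mapIso (shiftByShiftByIso X (by ring))⟩⟩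

end DoubleSuspension

end NComplex

/-! ### Collapsing intervals -/

namespace NComplex

section Collapse

/-- The map which sends the elements of each interval `[b, b + r]` with `b ≡ s mod N` to `b`, and
fixes the other integers. -/
noncomputable def collapseFun (N : ℕ) (s : ℤ) (r : ℕ) (m : ℤ) : ℤ :=
  if (m - s) % N ≤ r then m - (m - s) % N else m

variable {N : ℕ} {s : ℤ} {r : ℕ}

lemma collapseFun_eq {b m : ℤ} (hb : (N : ℤ) ∣ b - s) (h : b ≤ m) (h' : m < b + N) :
    collapseFun N s r m = if m - b ≤ r then b else m := by
  obtain ⟨q, hq⟩ := hb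
  have h1 : (m - s) % N = m - b := by
    have : m - s = m - b + N * q := by rw [← hq]; ring
    rw [this, Int.add_mul_emod_self_left, Int.emod_eq_of_lt (by omega) (by omega)]
  rw [collapseFun, h1, sub_sub_cancel]

lemma exists_base (hN : 0 < N) (s m : ℤ) : ∃ b : ℤ, (N : ℤ) ∣ b - s ∧ b ≤ m ∧ m < b + N := by
  refine ⟨m - (m - s) % N, ?_, ?_, ?_⟩
  · have : m - (m - s) % N - s = (m - s) - (m - s) % N := by ring
    rw [this]
    exact Int.dvd_self_sub_emod
  · have := Int.emod_nonneg (m - s) (show (N : ℤ) ≠ 0 by omega)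
    omega
  · have := Int.emod_lt_of_pos (m - s) (show 0 < (N : ℤ) by omega)
    omega

lemma dvd_add_self_sub {b : ℤ} (hb : (N : ℤ) ∣ b - s) : (N : ℤ) ∣ b + N - s := by
  have : b + (N : ℤ) - s = b - s + N := by ring
  rw [this]
  exact dvd_add hb dvd_rfl

lemma collapseFun_le (m : ℤ) (hN : 0 < N) : collapseFun N s r m ≤ m := by
  obtain ⟨b, hb, h1, h2⟩ := exists_base hN s m
  rw [collapseFun_eq hb h1 h2]
  split_ifs <;> omega

lemma collapseFun_add (m : ℤ) : collapseFun N s r (m + N) = collapseFun N s r m + N := by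
  have : m + (N : ℤ) - s = m - s + N := by ring
  simp only [collapseFun, this, Int.add_emod_right]
  split_ifs <;> ring

lemma collapseFun_monotone (hN : 0 < N) : Monotone (collapseFun N s r) := by
  refine monotone_int_of_le_succ fun m => ?_
  obtain ⟨b, hb, h1, h2⟩ := exists_base hN s m
  rw [collapseFun_eq hb h1 h2]
  by_cases h : m + 1 < b + N
  · rw [collapseFun_eq hb (by omega) h]
    split_ifs <;> omega
  · rw [collapseFun_eq (dvd_add_self_sub hb) (by omega) (by omega)]
    split_ifs <;> omega

lemma collapseFun_collapseFun (hN : 0 < N) (m : ℤ) :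
    collapseFun N s r (collapseFun N s r m) = collapseFun N s r m := by
  obtain ⟨b, hb, h1, h2⟩ := exists_base hN s m
  rw [collapseFun_eq hb h1 h2]
  by_cases h : m - b ≤ r
  · rw [if_pos h, collapseFun_eq hb le_rfl (by omega), if_pos (by omega)]
  · rw [if_neg h, collapseFun_eq hb h1 h2, if_neg h]

/-- The maps which collapse the complementary intervals `[a + r', a + r' + r]` and `[a, a + r']`:
an integer is fixed by the second one or, together with its image under the second one, by the
first one. -/
lemma collapseFun_complementary {r' : ℕ} (hr : r + r' + 1 = N) (a m : ℤ) :
    (collapseFun N (a + r') r m = m ∧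
      collapseFun N (a + r') r (collapseFun N a r' m) = collapseFun N a r' m) ∨
    collapseFun N a r' m = m := by
  obtain ⟨b, hb, h1, h2⟩ := exists_base (N := N) (by omega) a m
  have hb' : (N : ℤ) ∣ b + r' - (a + r') := by rwa [add_sub_add_right_eq_sub]
  have hb'' : (N : ℤ) ∣ b + r' - N - (a + r') := by
    have : b + r' - (N : ℤ) - (a + r') = b - a - N := by ring
    rw [this]
    exact dvd_sub hb dvd_rfl
  have hfix : ∀ n : ℤ, b ≤ n → n ≤ b + r' → collapseFun N (a + r') r n = n := by
    intro n hn hn'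
    by_cases h : n = b + r'
    · rw [collapseFun_eq hb' (by omega) (by omega)]
      split_ifs <;> omega
    · rw [collapseFun_eq hb'' (by omega) (by omega), if_neg (by omega)]
  rw [collapseFun_eq hb h1 h2]
  by_cases h : m - b ≤ r'
  · rw [if_pos h]
    exact Or.inl ⟨hfix m h1 (by omega), hfix b le_rfl (by omega)⟩
  · rw [if_neg h]
    exact Or.inr rfl

/-- `collapseFun` as a functor. -/
noncomputable def collapse (hN : 0 < N) (s : ℤ) (r : ℕ) : ℤ ⥤ ℤ :=
  (collapseFun_monotone (s := s) (r := r) hN).functor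

lemma isPeriodic_collapse (hN : 0 < N) (s : ℤ) (r : ℕ) : IsPeriodic N (collapse hN s r) :=
  fun m => collapseFun_add m

/-- The natural transformation expressing that `collapseFun` is bounded above by the identity. -/
noncomputable def collapseη (hN : 0 < N) (s : ℤ) (r : ℕ) : collapse hN s r ⟶ 𝟭 ℤ where
  app m := homOfLE (collapseFun_le m hN)
  naturality _ _ _ := Subsingleton.elim _ _

variable {B : Type u} [Category.{v} B]

lemma isIso_map_of_eq (X : ℤ ⥤ B) {i j : ℤ} (f : i ⟶ j) (h : i = j) : IsIso (X.map f) := by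
  subst h
  rw [Subsingleton.elim f (𝟙 i), X.map_id]
  infer_instance

variable [Preadditive B]

local notation "Q" => NHomotopyCategory.quotient B N

lemma isIso_of_isIso_app {X Y : NComplex B N} (f : X ⟶ Y) (h : ∀ m, IsIso (f.hom.app m)) :
    IsIso f := by
  rw [← ObjectProperty.isIso_hom_iff]
  exact NatIso.isIso_of_isIso_app _

lemma hasIdentities.isIso_tr {X : NComplex B N} (hX : hasIdentities B N s r X) {b i j : ℤ}
    (hb : (N : ℤ) ∣ b - s) (hi : b ≤ i) (hij : i ≤ j) (hj : j ≤ b + r) :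
    IsIso (tr X.obj i j) := by
  obtain ⟨k, rfl⟩ : ∃ k : ℕ, j = i + k := ⟨(j - i).toNat, by omega⟩
  induction k with
  | zero =>
    rw [tr_of_le X.obj hij]
    exact isIso_map_of_eq _ _ (by simp)
  | succ k ih =>
    push_cast at hj ⊢
    have h1 := ih (by omega) (by omega)
    obtain ⟨l, hl⟩ : ∃ l : ℕ, i + k = b + l := ⟨(i + k - b).toNat, by omega⟩
    obtain ⟨h, h2⟩ := hX b l ((Int.modEq_iff_dvd.2 hb).symm) (by omega)
    rw [← add_assoc, ← tr_comp X.obj (show i ≤ i + k by omega)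
      (show i + (k : ℤ) ≤ i + k + 1 by omega)]
    have h3 : IsIso (tr X.obj (i + k) (i + k + 1)) := by
      rw [hl, tr_of_le X.obj (by omega), h2]
      infer_instance
    infer_instance

lemma isCollapsed_of_hasIdentities (hN : 0 < N) {X : NComplex B N}
    (hX : hasIdentities B N s r X) :
    IsCollapsed (isPeriodic_collapse hN s r) (collapseη hN s r) X := by
  have : IsIso ((pullε (isPeriodic_collapse hN s r) (collapseη hN s r)).app X) := by
    refine isIso_of_isIso_app _ fun m => ?_
    change IsIso (X.obj.map ((collapseη hN s r).app m))
    obtain ⟨b, hb, h1, h2⟩ := exists_base hN s m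
    have h3 := collapseFun_eq (r := r) hb h1 h2
    rw [map_eq_tr]
    change IsIso (tr X.obj (collapseFun N s r m) m)
    by_cases h : m - b ≤ r
    · rw [h3.trans (if_pos h)]
      exact hX.isIso_tr hb le_rfl h1 (by omega)
    · rw [h3.trans (if_neg h), tr_self]
      infer_instance
  change IsIso ((Q).map _)
  infer_instance

lemma hasIdentities_pull_collapse (hN : 0 < N) (hr : r < N) (X : NComplex B N) :
    hasIdentities B N s r ((pull _ (isPeriodic_collapse hN s r)).obj X) := by
  intro i k hi hk
  have hi' : (N : ℤ) ∣ i - s := Int.modEq_iff_dvd.1 hi.symm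
  have h : (collapse hN s r).obj (i + k) = (collapse hN s r).obj (i + k + 1) := by
    change collapseFun N s r (i + k) = collapseFun N s r (i + k + 1)
    rw [collapseFun_eq hi' (by omega) (by omega), collapseFun_eq hi' (by omega) (by omega),
      if_pos (by omega), if_pos (by omega)]
  refine ⟨congr_arg X.obj.obj h, ?_⟩
  change X.obj.map _ = _
  rw [Subsingleton.elim ((collapse hN s r).map _) (eqToHom h), eqToHom_map]
  rfl

lemma isCollapsed_pull_collapse (hN : 0 < N) (X : NComplex B N) :
    IsCollapsed (isPeriodic_collapse hN s r) (collapseη hN s r)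
      ((pull _ (isPeriodic_collapse hN s r)).obj X) := by
  have : IsIso ((pullε (isPeriodic_collapse hN s r) (collapseη hN s r)).app
      ((pull _ (isPeriodic_collapse hN s r)).obj X)) := by
    refine isIso_of_isIso_app _ fun m => ?_
    change IsIso (X.obj.map ((collapse hN s r).map _))
    exact isIso_map_of_eq _ _ (collapseFun_collapseFun hN m)
  change IsIso ((Q).map _)
  infer_instance

/-- The subcategory `F_s^r` consists of the complexes which are collapsed along the map which
collapses the intervals `[b, b + r]` with `b ≡ s mod N`. -/
lemma F_quotient_iff (hN : 0 < N) (hr : r < N) (X : NComplex B N) :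
    NHomotopyCategory.F B N s r ((Q).obj X) ↔
      IsCollapsed (isPeriodic_collapse hN s r) (collapseη hN s r) X := by
  constructor
  · rintro ⟨X', hX', ⟨e⟩⟩
    exact isCollapsed_of_iso e (isCollapsed_of_hasIdentities hN hX')
  · intro h
    have : IsIso ((Q).map ((pullε (isPeriodic_collapse hN s r) (collapseη hN s r)).app X)) := h
    exact ⟨_, hasIdentities_pull_collapse hN hr X,
      ⟨asIso ((Q).map ((pullε (isPeriodic_collapse hN s r) (collapseη hN s r)).app X))⟩⟩

/-- Morphisms from a complex with identities on `[p, p + r]` to a complex with identities on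
`[a, p]` are null-homotopic if `[a, p + r]` has length `N - 1`: one may take the homotopy
`Xᵖ⁺ʳ = Xᵖ ⟶ Yᵖ = Yᵃ`. -/
lemma nullHomotopic_of_hasIdentities {r' : ℕ} (hr : r + r' + 1 = N) {a : ℤ} {X Y : NComplex B N}
    (hX : hasIdentities B N (a + r') r X) (hY : hasIdentities B N a r' Y) (f : X ⟶ Y) :
    NullHomotopic f := by
  classical
  have hXiso : ∀ {c i j : ℤ}, (N : ℤ) ∣ c - (a + r' + r) → c - r ≤ i → i ≤ j → j ≤ c →
      IsIso (tr X.obj i j) := fun {c i j} hc h1 h2 h3 =>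
    hX.isIso_tr (b := c - r) (by rwa [show c - (r : ℤ) - (a + r') = c - (a + r' + r) by ring])
      h1 h2 (by omega)
  have hYiso : ∀ {c i j : ℤ}, (N : ℤ) ∣ c - (a + r' + r) → c - N + 1 ≤ i → i ≤ j → j ≤ c - r →
      IsIso (tr Y.obj i j) := fun {c i j} hc h1 h2 h3 =>
    hY.isIso_tr (b := c - N + 1)
      (by rwa [show c - (N : ℤ) + 1 - a = c - (a + r' + r) by omega]) h1 h2 (by omega)
  refine nullHomotopic_of_factors f (a + r' + r) (by omega)
    (fun c => if hc : (N : ℤ) ∣ c - (a + r' + r) then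
      haveI := hXiso hc le_rfl (show c - r ≤ c by omega) le_rfl
      haveI := hYiso hc le_rfl (show c - N + 1 ≤ c - r by omega) le_rfl
      inv (tr X.obj (c - r) c) ≫ f.hom.app (c - r) ≫ inv (tr Y.obj (c - N + 1) (c - r))
      else 0) fun c m hc h1 h2 => ?_
  have i1 := hXiso hc le_rfl (show c - r ≤ c by omega) le_rfl
  have i2 := hYiso hc le_rfl (show c - N + 1 ≤ c - r by omega) le_rfl
  rw [htpyTerm, dif_pos hc]
  by_cases h : m ≤ c - r
  · have i3 := hYiso hc le_rfl h1 h
    have e : inv (tr Y.obj (c - N + 1) (c - r)) ≫ tr Y.obj (c - N + 1) m ≫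
        tr Y.obj m (c - r) = 𝟙 _ := by
      rw [tr_comp Y.obj h1 h, IsIso.inv_hom_id]
    have i4 := hYiso hc h1 h le_rfl
    rw [← cancel_mono (tr Y.obj m (c - r)), ← tr_comp X.obj h (show c - (r : ℤ) ≤ c by omega)]
    simp only [Category.assoc, IsIso.hom_inv_id_assoc]
    rw [e, Category.comp_id, tr_naturality]
  · have i3 := hXiso hc le_rfl (show c - r ≤ m by omega) h2
    rw [← cancel_epi (tr X.obj (c - r) m), ← Category.assoc (tr X.obj (c - r) m),
      tr_comp X.obj (show c - (r : ℤ) ≤ m by omega) h2]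
    simp only [Category.assoc, IsIso.hom_inv_id_assoc]
    rw [← tr_comp Y.obj (show c - (N : ℤ) + 1 ≤ c - r by omega) (show c - (r : ℤ) ≤ m by omega),
      IsIso.inv_hom_id_assoc, tr_naturality]

variable [HasFiniteBiproducts B]

attribute [local instance] hasBinaryBiproducts_of_finite_biproducts

/-- A commutative square in which, in each degree, two opposite morphisms are isomorphisms gives
rise to a split sequence. -/
lemma isSplitSeq_of_square {X Y Z W : NComplex B N} {g : X ⟶ Y} {h : X ⟶ Z} {k : Y ⟶ W}
    {l : Z ⟶ W} (sq : g ≫ k = h ≫ l)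
    (hm : ∀ m, (IsIso (g.hom.app m) ∧ IsIso (l.hom.app m)) ∨
      (IsIso (h.hom.app m) ∧ IsIso (k.hom.app m))) :
    IsSplitSeq (dirSumLift g (-h)) (dirSumDesc k l) := isSplitSeq_dirSum _ _ _ _ fun m => by
  have sq' : g.hom.app m ≫ k.hom.app m = h.hom.app m ≫ l.hom.app m :=
    congr_arg (fun f => f.hom.app m) sq
  have hneg : (-h).hom.app m = -h.hom.app m := rfl
  rw [hneg]
  rcases hm m with ⟨_, _⟩ | ⟨_, _⟩
  · refine ⟨inv (g.hom.app m), 0, 0, inv (l.hom.app m), by simp, by simp, by simp, ?_, by simp,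
      by simp⟩
    rw [← cancel_epi (g.hom.app m), ← cancel_mono (l.hom.app m)]
    simp [sq']
  · refine ⟨0, -inv (h.hom.app m), inv (k.hom.app m), 0, by simp, by simp, by simp, by simp, ?_,
      by simp⟩
    rw [← cancel_epi (h.hom.app m), ← cancel_mono (k.hom.app m)]
    simp [sq']

/-- If `Z ⟶ E ⟶ Y` is split, so is the induced sequence `Z ⟶ C(u) ⟶ C(u ≫ p)` for all
`u : X ⟶ E`. -/
lemma IsSplitSeq.coneMap {X Y Z E : NComplex B N} {i : Z ⟶ E} {p : E ⟶ Y} (h : IsSplitSeq i p)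
    (u : X ⟶ E) {g : X ⟶ Y} (hg : u ≫ p = 𝟙 X ≫ g) :
    IsSplitSeq (i ≫ coneInl u) (coneMap (𝟙 X) p hg) := fun m => by
  obtain ⟨r, t, h1, h2, h3⟩ := h m
  have hid : ((suspension B N).map (𝟙 X)).hom.app m = 𝟙 _ := by
    rw [(suspension B N).map_id]
    rfl
  have e1 : coneInr u m ≫ (NComplex.coneMap (𝟙 X) p hg).hom.app m = coneInr g m :=
    (coneInr_coneMap_app (𝟙 X) p hg m).trans
      ((congr_arg (fun x => x ≫ coneInr g m) hid).trans (Category.id_comp _))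
  have e0 : (i ≫ coneInl u).hom.app m = i.hom.app m ≫ (coneInl u).hom.app m := rfl
  rw [e0]
  refine ⟨coneFst u m ≫ r, coneDescApp g (t ≫ (coneInl u).hom.app m) (coneInr u m), ?_,
    cone_app_ext ?_ ?_, cone_app_ext ?_ ?_⟩
  · rw [Category.assoc, ← Category.assoc _ (coneFst u m), coneInl_fst, Category.id_comp, h1]
  · rw [← Category.assoc, coneInl_descApp, Category.assoc, coneInl_coneMap_app, ← Category.assoc,
      h2, Category.id_comp, Category.comp_id]
  · rw [← Category.assoc, coneInr_descApp, e1, Category.comp_id]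
  · have e2 := coneInl_coneMap_app (𝟙 X) p hg m
    rw [Preadditive.comp_add, Category.assoc, ← Category.assoc _ (coneFst u m), coneInl_fst,
      Category.id_comp, reassoc_of% e2, coneInl_descApp, ← Category.assoc, ← Category.assoc,
      ← Preadditive.add_comp, h3, Category.id_comp, Category.comp_id]
  · rw [Preadditive.comp_add, Category.assoc, ← Category.assoc _ (coneFst u m), coneInr_fst,
      zero_comp, zero_add, reassoc_of% e1, coneInr_descApp, Category.comp_id]

lemma dirSumLift_desc {W X Y Z : NComplex B N} (f : W ⟶ X) (g : W ⟶ Y) (k : X ⟶ Z) (l : Y ⟶ Z) :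
    dirSumLift f g ≫ dirSumDesc k l = f ≫ k + g ≫ l :=
  hom_ext fun _ => biprod.lift_desc

/-- In the situation of `isSplitSeq_of_square`, the cones of the two parallel morphisms `g` and `l`
are isomorphic in the homotopy category. -/
lemma nonempty_iso_cone_of_square (hN : 2 ≤ N) {X Y Z W : NComplex B N} {g : X ⟶ Y} {h : X ⟶ Z}
    {k : Y ⟶ W} {l : Z ⟶ W} (H : IsSplitSeq (dirSumLift g (-h)) (dirSumDesc k l)) :
    Nonempty ((Q).obj (cone g) ≅ (Q).obj (cone l)) := by
  have hYZ : IsSplitSeq (dirSumLift (0 : Z ⟶ Y) (𝟙 Z)) (dirSumDesc (𝟙 Y) 0) :=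
    isSplitSeq_dirSum _ _ _ _ fun m => ⟨0, 𝟙 _, 𝟙 _, 0, by simp⟩
  have hg : dirSumLift g (-h) ≫ dirSumDesc (𝟙 Y) 0 = 𝟙 X ≫ g := by
    rw [dirSumLift_desc, comp_zero, add_zero, Category.comp_id, Category.id_comp]
  have h1 := hYZ.coneMap (dirSumLift g (-h)) hg
  have h2 := h1.isIso_coneToQuot hN
  have h3 := H.isIso_coneToQuot hN
  have hl : (dirSumLift (0 : Z ⟶ Y) (𝟙 Z) ≫ coneInl (dirSumLift g (-h))) ≫
      coneToQuot _ H.comp_eq_zero = 𝟙 Z ≫ l := by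
    rw [Category.assoc, coneInl_coneToQuot, dirSumLift_desc, zero_comp, zero_add]
  have h4 : IsIso ((Q).map (𝟙 Z)) := inferInstance
  have h5 := isIso_quotient_coneMap hN _ _ hl
  exact ⟨(asIso ((Q).map (coneToQuot _ h1.comp_eq_zero))).symm ≪≫
    asIso ((Q).map (NComplex.coneMap _ _ hl))⟩

/-- The cone of the morphism from the complex collapsed on `[p, p + r]` to `X` is collapsed on the
complementary interval `[a, p]`. -/
lemma isCollapsed_cone_pullε (hN : 2 ≤ N) (hN' : 0 < N) {r' : ℕ} (hr : r + r' + 1 = N) (a : ℤ)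
    (X : NComplex B N) :
    IsCollapsed (isPeriodic_collapse hN' a r') (collapseη hN' a r')
      (cone ((pullε (isPeriodic_collapse hN' (a + r') r) (collapseη hN' (a + r') r)).app X)) := by
  let ε := pullε (B := B) (isPeriodic_collapse hN' (a + r') r) (collapseη hN' (a + r') r)
  let ε' := pullε (B := B) (isPeriodic_collapse hN' a r') (collapseη hN' a r')
  have sq := ε'.naturality (ε.app X)
  obtain ⟨e⟩ := nonempty_iso_cone_of_square hN (isSplitSeq_of_square sq fun m => by
    rcases collapseFun_complementary hr a m with ⟨h1, h2⟩ | h1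
    · exact Or.inl ⟨isIso_map_of_eq X.obj _ h2, isIso_map_of_eq X.obj _ h1⟩
    · exact Or.inr ⟨isIso_map_of_eq X.obj _ (congr_arg (collapseFun N (a + r') r) h1),
        isIso_map_of_eq X.obj _ h1⟩)
  exact isCollapsed_of_iso e (isCollapsed_cone hN _ (isCollapsed_pull_collapse hN' _)
    (isCollapsed_pull_collapse hN' _))

end Collapse

end NComplex

/-! ### Recollements -/

namespace NHomotopyCategory

open NComplex

section Recollements

variable {B : Type u} [Category.{v} B] [Preadditive B] {N : ℕ}

local notation "Q" => NHomotopyCategory.quotient B N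

lemma F_of_iso {s : ℤ} {r : ℕ} {X Y : NHomotopyCategory B N} (e : X ≅ Y) (hX : F B N s r X) :
    F B N s r Y :=
  ObjectProperty.prop_of_iso ((hasIdentities B N s r).map (Q)) e hX

lemma F_add_self (s : ℤ) (r : ℕ) : F B N (s + N) r = F B N s r := by
  have : hasIdentities B N (s + N) r = hasIdentities B N s r := by
    unfold hasIdentities
    simp only [Int.modEq_iff_dvd, add_sub_right_comm _ (N : ℤ), dvd_add_self_right]
  rw [F, this, F]

variable [HasFiniteBiproducts B]

lemma exists_isZero_F (hN : 0 < N) {s : ℤ} {r : ℕ} (hr : r < N) :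
    ∃ X : NHomotopyCategory B N, IsZero X ∧ F B N s r X := by
  have := hasZeroObject_of_hasFiniteBiproducts B
  obtain ⟨z, hz⟩ := HasZeroObject.zero (C := B)
  let Z : NComplex B N := ⟨(Functor.const ℤ).obj z, fun i => hz.eq_of_src _ _⟩
  have hZ : NullHomotopic (𝟙 Z) := by
    have : 𝟙 Z = 0 := hom_ext fun m => hz.eq_of_src _ _
    rw [this]
    exact NullHomotopic.zero
  refine ⟨(Q).obj Z, ?_, (F_quotient_iff hN hr Z).2 (isCollapsed_of_contractible hZ)⟩
  rw [IsZero.iff_id_eq_zero, ← (Q).map_id]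
  exact (quotient_map_eq_zero_iff _).2 hZ

lemma F_map_translation (hN : 2 ≤ N) {s : ℤ} {r : ℕ} (hr : r < N) :
    (F B N s r).map (translation B N) = F B N s r := by
  have hN' : 0 < N := by omega
  funext X
  refine propext ⟨?_, fun hX => ?_⟩
  · rintro ⟨Y, hY, ⟨e⟩⟩
    refine F_of_iso e ?_
    exact (F_quotient_iff hN' hr _).2 (((F_quotient_iff hN' hr Y.as).1 hY).suspension hN)
  · obtain ⟨Y, hY, ⟨e⟩⟩ :=
      ((F_quotient_iff hN' hr X.as).1 hX).exists_suspension_iso hN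
    exact ⟨(Q).obj Y, (F_quotient_iff hN' hr Y).2 hY, ⟨e⟩⟩

/-- The subcategories `F_s^r` are triangulated. -/
lemma isFullTriangulatedSubcategory_F (hN : 2 ≤ N) (s : ℤ) {r : ℕ} (hr : r < N) :
    IsFullTriangulatedSubcategory (translation B N) (distinguished B N) (F B N s r) where
  of_iso := F_of_iso
  zero := exists_isZero_F (by omega) hr
  shift_eq := F_map_translation hN hr
  ext₁ := by
    rintro T ⟨X, Y, f, e₁, e₂, e₃, -⟩ h₂ h₃
    have hN' : 0 < N := by omega
    -- `Y ⟶ C(f) ⟶ ΣX` is split, so `ΣX` is collapsed, and hence so is `X`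
    refine F_of_iso e₁.symm ((F_quotient_iff hN' hr X).2 (isCollapsed_of_suspension hN ?_))
    exact (isSplitSeq_cone f).isCollapsed₃ hN ((F_quotient_iff hN' hr Y).1 (F_of_iso e₂ h₂))
      ((F_quotient_iff hN' hr (cone f)).1 (F_of_iso e₃ h₃))
  ext₂ := by
    rintro T ⟨X, Y, f, e₁, e₂, e₃, -⟩ h₁ h₃
    have hN' : 0 < N := by omega
    have hX := (F_quotient_iff hN' hr X).1 (F_of_iso e₁ h₁)
    have hC := (F_quotient_iff hN' hr (cone f)).1 (F_of_iso e₃ h₃)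
    refine F_of_iso e₂.symm ((F_quotient_iff hN' hr Y).2 (isCollapsed_of_suspension hN ?_))
    -- rotating the triangle twice: `C(Y ⟶ C(f))` is isomorphic to `ΣX`, and `C(f) ⟶ C(Y ⟶ C(f))`
    -- is a split monomorphism in each degree, with cokernel `ΣY`
    have := (isSplitSeq_cone f).isIso_coneToQuot hN
    exact (isSplitSeq_cone (coneInl f)).isCollapsed₃ hN hC
      (isCollapsed_of_iso (asIso ((Q).map (coneToQuot _ (isSplitSeq_cone f).comp_eq_zero))).symm
        (hX.suspension hN))
  ext₃ := by
    rintro T ⟨X, Y, f, e₁, e₂, e₃, -⟩ h₁ h₂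
    have hN' : 0 < N := by omega
    exact F_of_iso e₃.symm ((F_quotient_iff hN' hr (cone f)).2 (isCollapsed_cone hN f
      ((F_quotient_iff hN' hr X).1 (F_of_iso e₁ h₁))
      ((F_quotient_iff hN' hr Y).1 (F_of_iso e₂ h₂))))

/-- Collapsing two complementary intervals `[p, p + r]` and `[a, p]`, where `[a, p + r]` has length
`N - 1`, yields a stable t-structure. -/
lemma isStableTStructure_F (hN : 2 ≤ N) (a : ℤ) {r r' : ℕ} (hr : r + r' + 1 = N) :
    IsStableTStructure (translation B N) (distinguished B N) (F B N (a + r') r)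
      (F B N a r') where
  shift_left := F_map_translation hN (by omega)
  shift_right := F_map_translation hN (by omega)
  hom_eq_zero := by
    rintro X Y ⟨X', hX, ⟨e⟩⟩ ⟨Y', hY, ⟨e'⟩⟩ f
    obtain ⟨g, hg⟩ := (Q).map_surjective (e.hom ≫ f ≫ e'.inv)
    have h0 : e.hom ≫ f ≫ e'.inv = 0 := by
      rw [← hg, quotient_map_eq_zero_iff]
      exact nullHomotopic_of_hasIdentities hr hX hY g
    rw [← cancel_epi e.hom, ← cancel_mono e'.inv, Category.assoc, h0, comp_zero, zero_comp]
  exists_triangle X := by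
    have hN' : 0 < N := by omega
    let ε := (pullε (B := B) (isPeriodic_collapse hN' (a + r') r)
      (collapseη hN' (a + r') r)).app X.as
    refine ⟨_, _, (Q).map ε, (Q).map (coneInl ε), (Q).map (coneSnd ε),
      (F_quotient_iff hN' (by omega) _).2 (isCollapsed_pull_collapse hN' X.as),
      (F_quotient_iff hN' (by omega) _).2 (isCollapsed_cone_pullε hN hN' hr a X.as),
      _, _, ε, Iso.refl _, Iso.refl _, Iso.refl _, ?_, ?_, ?_⟩
    · exact (Category.comp_id _).trans (Category.id_comp _).symm
    · exact (Category.comp_id _).trans (Category.id_comp _).symm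
    · refine Eq.trans ?_ (Category.id_comp _).symm
      exact (congr_arg (_ ≫ ·) ((translation B N).map_id _)).trans (Category.comp_id _)

end Recollements

end NHomotopyCategory

lemma val_finRotate {n : ℕ} (i : Fin n) :
    (finRotate n i : ℕ) = if (i : ℕ) + 1 = n then 0 else (i : ℕ) + 1 := by
  cases n with
  | zero => exact i.elim0
  | succ n =>
    rw [coe_finRotate]
    simp only [Fin.ext_iff, Fin.val_last, Nat.add_right_cancel_iff]

theorem mainTheorem3 {B : Type u} [Category.{v} B] [Preadditive B] [HasFiniteBiproducts B]
    (N : ℕ) (hN : 2 ≤ N) (s : ℤ) :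
    IsPolygonOfRecollements (NHomotopyCategory.translation B N)
      (NHomotopyCategory.distinguished B N) (NHomotopyCategory.polygon B N s) := by
  refine ⟨fun i => ?_, fun i => ?_⟩
  · unfold NHomotopyCategory.polygon
    split_ifs
    · exact NHomotopyCategory.isFullTriangulatedSubcategory_F hN _ (by omega)
    · exact NHomotopyCategory.isFullTriangulatedSubcategory_F hN _ (by omega)
  · obtain ⟨i, hi⟩ := i
    unfold NHomotopyCategory.polygon
    rw [val_finRotate]
    dsimp only
    rcases Nat.even_or_odd' i with ⟨k, rfl | rfl⟩
    · rw [if_pos (by omega), if_neg (by omega : ¬ 2 * k + 1 = 2 * N), if_neg (by omega)]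
      have h1 : 2 * k / 2 = k := by omega
      have h2 : (2 * k + 1) / 2 = k := by omega
      rw [h1, h2]
      exact NHomotopyCategory.isStableTStructure_F hN (s + k) (r := N - 2) (r' := 1) (by omega)
    · -- here the second interval starts at `s + k + 2 - N`, which is `s + k + 2` modulo `N`
      have h2 : (2 * k + 1) / 2 = k := by omega
      have h := NHomotopyCategory.isStableTStructure_F (B := B) hN (s + k + 2 - N) (r := 1)
        (r' := N - 2) (by omega)
      have e : s + k + 2 - (N : ℤ) + (N - 2 : ℕ) = s + k := by omega
      rw [e, ← NHomotopyCategory.F_add_self (s + k + 2 - N), sub_add_cancel] at h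
      rw [if_neg (by omega), h2]
      by_cases hk : 2 * k + 1 + 1 = 2 * N
      · have e' : s + (k : ℤ) + 2 = s + 1 + N := by omega
        rw [if_pos hk, if_pos (by omega)]
        rw [e', NHomotopyCategory.F_add_self] at h
        simpa using h
      · have e' : s + (((2 * k + 1 + 1) / 2 : ℕ) : ℤ) + 1 = s + k + 2 := by omega
        rw [if_neg hk, if_pos (by omega), e']
        exact h
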